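/- Conventions. Let $R$ be a commutative ring with total ring of fractions $Q$ (the localization at all non-zero-divisors). An $R$-module $M$ has rank $e$ if $M\otimes_R Q\cong Q^e$. The grade of an ideal is the supremum of the lengths of the regular sequences contained in it ($\infty$ for the unit ideal). For a matrix $A$, $I_t(A)$ is the ideal generated by its $t\times t$ minors ($I_0(A)$ is the unit ideal). If $\varphi$ is an $n\times m$ matrix presenting $M$, i.e. $R^m\xrightarrow{\varphi}R^n\to M\to 0$ is exact, then $F_i(M)=I_{n-i}(\varphi)$ is the $i$-th Fitting ideal. For $f\colon M\to R^e$, $\det_f(M)\subseteq R$ is the image of $\bigwedge^e f\colon\bigwedge^e M\to\bigwedge^e R^e\cong R$; for $M$ of rank $e$, $\det_0(M)$ denotes any ideal $\det_f(M)$ with $\operatorname{im} f$ of rank $e$ (such $f$ exist if $M$ is finitely generated), and $[[M]]_R$ is the isomorphism class of the image of $\bigwedge^e M\to(\bigwedge^e M)\otimes_R Q\cong Q$. Let $(R,\mathfrak m)$ be a Noetherian local ring and $E$ a finitely generated $R$-module of rank $e\ge 2$ with $\operatorname{grade}F_e(E)\ge 2$. Let $a_1,\dots,a_k\in E$ generate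 a submodule $U$ such that $E/U$ is a torsion module (for example $U=E$, or $U$ a reduction of $E$). Put $R'=R[z_{ij}\mid 1\le i\le k,\ 1\le j\le e-1]$, $R''=R'_{\mathfrak mR'}$, $E''=E\otimes_R R''$, $x_j=\sum_{i=1}^k z_{ij}a_i$ and $F=\sum_{j=1}^{e-1}R''x_j\subseteq E''$. Let $I$ be a generic Bourbaki ideal of $E$ (with respect to $U$), i.e. an $R''$-ideal with $I\cong E''/F$. Let $x_1,\dots,x_{e-1},x_e,\dots,x_n$ be any generating family of $E''$ extending $x_1,\dots,x_{e-1}$ (such families exist). For an $n\times m$ matrix $\varphi$ presenting $E''$ with respect to $x_1,\dots,x_n$ and a choice of $n-e$ of its columns, let $\rho$ be the $n\times(n-e)$ submatrix of $\varphi$ formed by these columns, and let $\psi$ be the $(n-e+1)\times(n-e)$ submatrix formed by rows $e,\dots,n$ of $\rho$. (a) There are a presentation matrix $\varphi$ with respect to $x_1,\dots,x_n$ and a choice of columns with $\operatorname{grade}I_{n-e}(\psi)\ge 1$. For every such $\varphi$ and every such choice, $$I\cong I_{n-e}(\psi)\subseteq I_{n-e}(\rho)\subseteq F_e(E''),\qquad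 I_{n-e}(\rho)\cong[[E'']]_{R''}\cong\det\nolimits_0(E)\cdot R''$$ (isomorphisms of $R''$-modules). (b) If moreover $\operatorname{pd}_R E=1$, then there are presentation matrices $\varphi$ with respect to $x_1,\dots,x_n$ which have exactly $n-e$ columns, and for each of them (so $\rho=\varphi$) one has $\operatorname{grade}I_{n-e}(\psi)\ge 1$ and $$I\cong I_{n-e}(\psi)\subseteq I_{n-e}(\rho)=F_e(E'').$$ -/

import Mathlib

open scoped TensorProduct

universe u v w

noncomputable section

namespace BourbakiNorm

/-- The module `M` has rank `e` over `R`: `M ⊗ Q ≅ Q ^ e`, with `Q` the total ring of fractions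
of `R` (the localization at all non-zero-divisors; `R` need not be a domain). -/
def HasRank (R : Type u) [CommRing R] (M : Type v) [AddCommGroup M] [Module R M] (e : ℕ) : Prop :=
  Nonempty ((FractionRing R ⊗[R] M) ≃ₗ[FractionRing R] (Fin e → FractionRing R))

/-- The grade of an ideal `I`: the supremum of the lengths of the (weakly) regular sequences
contained in `I`. For a proper ideal these are exactly the regular sequences in `I`, and
the grade of the unit ideal is `⊤`, the usual convention. -/
def idealGrade {R : Type u} [CommRing R] (I : Ideal R) : ℕ∞ :=
  ⨆ rs : {rs : List R // (∀ r ∈ rs, r ∈ I) ∧ RingTheory.Sequence.IsWeaklyRegular R rs},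
    (rs.1.length : ℕ∞)

/-- `I_t(A)`, the ideal generated by the `t × t` minors of `A` (so `I_0(A)` is the unit ideal). -/
def minorsIdeal {R : Type u} [CommRing R] {ι : Type v} {κ : Type w} (t : ℕ) (A : Matrix ι κ R) :
    Ideal R :=
  Ideal.span {y | ∃ (f : Fin t ↪ ι) (g : Fin t ↪ κ), y = (A.submatrix f g).det}

/-- `φ` presents `M` with respect to the generators `x`: the sequence
`R ^ κ --φ--> R ^ ι --x--> M --> 0` is exact. -/
structure IsPresentedBy {R : Type u} [CommRing R] {M : Type v} [AddCommGroup M] [Module R M]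
    {ι κ : Type*} [Fintype ι] [Fintype κ] (x : ι → M) (φ : Matrix ι κ R) : Prop where
  span_eq_top : Submodule.span R (Set.range x) = ⊤
  range_eq_ker : LinearMap.range φ.mulVecLin = LinearMap.ker (Fintype.linearCombination R x)

/-- The Fitting ideal `F_i(M)` of a finitely presented module: the ideal `I_{n-i}(φ)`
for an `n × m` matrix `φ` presenting `M`. The ideal does not depend on the presentation, so
the supremum below is over a family all of whose members agree. For `n ≤ i` the truncated
subtraction gives `I_0(φ) = R`, as it should. -/
def fittingIdeal (R : Type u) [CommRing R] (M : Type v) [AddCommGroup M] [Module R M] (i : ℕ) :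
    Ideal R :=
  ⨆ (n : ℕ) (m : ℕ) (x : Fin n → M) (φ : Matrix (Fin n) (Fin m) R) (_ : IsPresentedBy x φ),
    minorsIdeal (n - i) φ

/-- `det_f(M)` for `f : M → R ^ e`: the ideal which is the image of
`⋀ ^ e f : ⋀ ^ e M → ⋀ ^ e (R ^ e) ≅ R`, the last isomorphism being the one given by the
determinant. -/
def detIdeal {R : Type u} [CommRing R] {M : Type v} [AddCommGroup M] [Module R M] {e : ℕ}
    (f : M →ₗ[R] (Fin e → R)) : Ideal R :=
  LinearMap.range
    ((exteriorPower.alternatingMapLinearEquiv (Matrix.detRowAlternating (n := Fin e) (R := R))) ∘ₗ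
      exteriorPower.map e f)

/-- The image of `⋀ ^ e M → Q ⊗ ⋀ ^ e M ≅ Q` for a choice `θ` of the isomorphism. -/
def normModule {R : Type u} [CommRing R] {M : Type v} [AddCommGroup M] [Module R M] {e : ℕ}
    (θ : (FractionRing R ⊗[R] (⋀[R]^e M)) ≃ₗ[FractionRing R] FractionRing R) :
    Submodule R (FractionRing R) :=
  LinearMap.range ((θ.toLinearMap.restrictScalars R) ∘ₗ
    TensorProduct.mk R (FractionRing R) (⋀[R]^e M) 1)

/-- The ideal `J` represents the norm `[[M]]_R` of a module `M` of rank `e`: it is isomorphic to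
the image of `⋀ ^ e M → Q ⊗ ⋀ ^ e M ≅ Q`. -/
def RepresentsNorm {R : Type u} [CommRing R] (M : Type v) [AddCommGroup M] [Module R M] (e : ℕ)
    (J : Ideal R) : Prop :=
  ∃ θ : (FractionRing R ⊗[R] (⋀[R]^e M)) ≃ₗ[FractionRing R] FractionRing R,
    Nonempty (J ≃ₗ[R] normModule θ)

instance isPrime_map_C (R : Type u) [CommRing R] [IsLocalRing R] (σ : Type v) :
    ((IsLocalRing.maximalIdeal R).map (MvPolynomial.C : R →+* MvPolynomial σ R)).IsPrime := by
  rw [← Ideal.Quotient.isDomain_iff_prime]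
  exact (MvPolynomial.quotientEquivQuotientMvPolynomial (σ := σ)
    (IsLocalRing.maximalIdeal R)).symm.toMulEquiv.isDomain _

/-- The Nagata extension `R(Z) = R[Z]_{𝔪 R[Z]}` of a local ring `(R, 𝔪)`, for a set `Z` of
indeterminates indexed by `σ`. -/
def NagataExt (R : Type u) [CommRing R] [IsLocalRing R] (σ : Type v) : Type (max u v) :=
  Localization.AtPrime
    ((IsLocalRing.maximalIdeal R).map (MvPolynomial.C : R →+* MvPolynomial σ R))

section Nagata

variable (R : Type u) [CommRing R] [IsLocalRing R] (σ : Type v)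

instance : CommRing (NagataExt R σ) :=
  inferInstanceAs (CommRing (Localization.AtPrime
    ((IsLocalRing.maximalIdeal R).map (MvPolynomial.C : R →+* MvPolynomial σ R))))

instance : Algebra (MvPolynomial σ R) (NagataExt R σ) :=
  inferInstanceAs (Algebra (MvPolynomial σ R) (Localization.AtPrime
    ((IsLocalRing.maximalIdeal R).map (MvPolynomial.C : R →+* MvPolynomial σ R))))

instance : Algebra R (NagataExt R σ) :=
  inferInstanceAs (Algebra R (Localization.AtPrime
    ((IsLocalRing.maximalIdeal R).map (MvPolynomial.C : R →+* MvPolynomial σ R))))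

instance : IsScalarTower R (MvPolynomial σ R) (NagataExt R σ) :=
  inferInstanceAs (IsScalarTower R (MvPolynomial σ R) (Localization.AtPrime
    ((IsLocalRing.maximalIdeal R).map (MvPolynomial.C : R →+* MvPolynomial σ R))))

instance : IsLocalization.AtPrime (NagataExt R σ)
    ((IsLocalRing.maximalIdeal R).map (MvPolynomial.C : R →+* MvPolynomial σ R)) :=
  inferInstanceAs (IsLocalization.AtPrime (Localization.AtPrime
    ((IsLocalRing.maximalIdeal R).map (MvPolynomial.C : R →+* MvPolynomial σ R))) _)

end Nagata

section Bourbaki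

variable {R : Type u} [CommRing R] [IsLocalRing R] {E : Type v} [AddCommGroup E] [Module R E]
  {k d : ℕ}

/-- The generic elements `x_j = ∑ i, z_ij a_i` of `E'' = R'' ⊗ E`, where
`R'' = R(z_ij | 1 ≤ i ≤ k, 1 ≤ j ≤ d)`. -/
def genericElement (a : Fin k → E) (j : Fin d) : NagataExt R (Fin k × Fin d) ⊗[R] E :=
  ∑ i, algebraMap (MvPolynomial (Fin k × Fin d) R) (NagataExt R (Fin k × Fin d))
    (MvPolynomial.X (i, j)) ⊗ₜ[R] a i

/-- The submodule `F = ∑ j, R'' x_j` of `E''`. -/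
def genericSubmodule (d : ℕ) (a : Fin k → E) :
    Submodule (NagataExt R (Fin k × Fin d)) (NagataExt R (Fin k × Fin d) ⊗[R] E) :=
  Submodule.span _ (Set.range (genericElement (d := d) (R := R) a))

/-- For a module `E` of rank `e`, the ideal `I` of `R'' = R(z_ij | 1 ≤ i ≤ k, 1 ≤ j ≤ e - 1)`
is a generic Bourbaki ideal of `E` with respect to the submodule `U = ∑ i, R a_i`: the module
`E / U` is torsion and `I ≅ E'' / F`. The case `U = E` is that of a generic Bourbaki ideal of `E`;
every reduction `U` of `E` is allowed as well, since then `E / U` is torsion. -/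
structure IsGenericBourbakiIdeal (e : ℕ) (a : Fin k → E)
    (I : Ideal (NagataExt R (Fin k × Fin (e - 1)))) : Prop where
  isTorsion : Module.IsTorsion R (E ⧸ Submodule.span R (Set.range a))
  iso : Nonempty (I ≃ₗ[NagataExt R (Fin k × Fin (e - 1))]
    ((NagataExt R (Fin k × Fin (e - 1)) ⊗[R] E) ⧸ genericSubmodule (R := R) (e - 1) a))

/-- The family `x` generates `E''` and begins with the generic elements `x_1, …, x_d`, followed
by `r + 1` further elements. -/
structure IsExtendedGeneratingFamily {r : ℕ} (a : Fin k → E)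
    (x : Fin d ⊕ Fin (r + 1) → NagataExt R (Fin k × Fin d) ⊗[R] E) : Prop where
  inl : ∀ j : Fin d, x (Sum.inl j) = genericElement a j
  span_eq_top : Submodule.span (NagataExt R (Fin k × Fin d)) (Set.range x) = ⊤

end Bourbaki

end BourbakiNorm

end

open BourbakiNorm

/-! The core is a duality of complementary minors. If `G` is an e × n matrix, `ρ` an n × (n - e)
matrix and `G * ρ = 0`, then the maximal minors of `G` and the signed complementary minors of `ρ`
are proportional (`complementary_minors`). Hence the two ideals of maximal minors are isomorphic as
soon as each contains a non-zero-divisor (`nonempty_minorsIdeal_equiv`). This is used twice. Taking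
for `G` the single row of generators of I that are the images of x_e, …, x_n, and ψ in the role of
`ρ`, gives I ≅ I_{n-e}(ψ). Taking for `G` the values on x_1, …, x_n of a map E'' → R''^e of rank e
gives I_{n-e}(ρ) ≅ det_0(E) R''.

The rank hypothesis enters through `IsCoordinates`: up to a non-zero-divisor t, a finitely generated
module of rank e has coordinates with respect to e of its elements. These pass to the e-th exterior
power and to flat base changes, so the image of det ∘ g represents the norm, and any two ideals
det_f with f of rank e are proportional.

It remains to produce non-zero-divisors. One lies in I because the determinant of the coordinates of
x_1, …, x_{e-1} and one further vector is a non-zero-divisor (`generic_det_mem_nonZeroDivisors`).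
One lies in I_{n-e}(ψ), for a suitable choice of relations, because R'' has infinitely many elements
with unit differences: these allow explicit relations on the generators of I (`exists_relations`),
which lift to relations on E''.

In projective dimension one the relation module over the local ring R'' is free of rank n - e. The
relations just constructed then factor through φ, which forces positive grade, and I_{n-e}(φ) is the
whole Fitting ideal by a block determinant comparing two presentations
(`IsPresentedBy.fittingIdeal_le`). -/

open scoped nonZeroDivisors

namespace BourbakiNorm

/-! ### Expansion of alternating maps in unit vectors -/

section Alternating

/-- The alternating map obtained by fixing the arguments with index in the left summand. -/
def fixLeft {R M N α β : Type*} [CommRing R] [AddCommGroup M] [Module R M] [AddCommGroup N]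
    [Module R N] (f : M [⋀^(α ⊕ β)]→ₗ[R] N) (a : α → M) : M [⋀^β]→ₗ[R] N where
  toFun w := f (Sum.elim a w)
  map_update_add' w i x y := by
    classical
    have h (z : M) : Sum.elim a (Function.update w i z) =
        Function.update (Sum.elim a w) (Sum.inr i) z := by
      ext (j | j)
      · simp
      · by_cases h : j = i
        · subst h; simp
        · simp [Function.update_of_ne h]
    convert f.map_update_add (Sum.elim a w) (Sum.inr i) x y using 2 <;>
      (congr 1; convert h _)
  map_update_smul' w i c x := by
    classical
    have h (z : M) : Sum.elim a (Function.update w i z) =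
        Function.update (Sum.elim a w) (Sum.inr i) z := by
      ext (j | j)
      · simp
      · by_cases h : j = i
        · subst h; simp
        · simp [Function.update_of_ne h]
    convert f.map_update_smul (Sum.elim a w) (Sum.inr i) c x using 2 <;>
      (congr 1; convert h _)
  map_eq_zero_of_eq' w i j hij hne :=
    f.map_eq_zero_of_eq (Sum.elim a w) (i := Sum.inr i) (j := Sum.inr j) hij (by simpa using hne)

theorem apply_mem_span_single {R ι β : Type*} [CommRing R] [Fintype ι] [DecidableEq ι]
    [Fintype β] (f : (ι → R) [⋀^β]→ₗ[R] R) (v : β → ι → R) :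
    f v ∈ Ideal.span (Set.range fun s : β ↪ ι => f fun j => Pi.single (s j) 1) := by
  classical
  have hv : v = fun j => ∑ i, v j i • (Pi.single i 1 : ι → R) := by
    ext j i
    simp [Finset.sum_apply, Pi.single_apply]
  rw [hv]
  have := f.toMultilinearMap.map_sum (fun j i => v j i • (Pi.single i 1 : ι → R))
  rw [AlternatingMap.coe_multilinearMap] at this
  rw [this]
  refine Ideal.sum_mem _ fun s _ => ?_
  have h2 := f.toMultilinearMap.map_smul_univ (fun j => v j (s j))
    (fun j => (Pi.single (s j) 1 : ι → R))
  rw [AlternatingMap.coe_multilinearMap] at h2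
  rw [h2, smul_eq_mul]
  by_cases hs : Function.Injective s
  · exact Ideal.mul_mem_left _ _ (Ideal.subset_span ⟨⟨s, hs⟩, rfl⟩)
  · rw [f.map_eq_zero_of_not_injective _ fun h => hs fun a b hab => h (by simp [hab]), mul_zero]
    exact zero_mem _

end Alternating

/-! ### Extending injections to enumerations -/

section Extend

theorem exists_equiv_extending_inr {α β ι : Type*} [Fintype α] [Fintype β] [Fintype ι]
    (h : Fintype.card ι = Fintype.card α + Fintype.card β) (s : β ↪ ι) :
    ∃ τ : α ⊕ β ≃ ι, ∀ b, τ (Sum.inr b) = s b := by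
  classical
  let σ : α ⊕ β ≃ ι := Fintype.equivOfCardEq (by simp [h])
  have hi : Function.Injective (fun b => σ (Sum.inr b)) := fun a b hab => by simpa using hab
  let e : {x // x ∈ Set.range fun b => σ (Sum.inr b)} ≃ {x // x ∈ Set.range s} :=
    (Equiv.ofInjective _ hi).symm.trans (Equiv.ofInjective s s.injective)
  refine ⟨σ.trans e.extendSubtype, fun b => ?_⟩
  rw [Equiv.trans_apply, e.extendSubtype_apply_of_mem _ ⟨b, rfl⟩]
  have : (Equiv.ofInjective _ hi).symm ⟨σ (Sum.inr b), ⟨b, rfl⟩⟩ = b :=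
    Equiv.ofInjective_symm_apply hi b
  simp only [e, Equiv.trans_apply]
  rw [this]
  rfl

theorem exists_equiv_extending_inl {α β ι : Type*} [Fintype α] [Fintype β] [Fintype ι]
    (h : Fintype.card ι = Fintype.card α + Fintype.card β) (s : α ↪ ι) :
    ∃ τ : α ⊕ β ≃ ι, ∀ b, τ (Sum.inl b) = s b := by
  obtain ⟨τ, hτ⟩ := exists_equiv_extending_inr (α := β) (h.trans (add_comm _ _)) s
  exact ⟨(Equiv.sumComm _ _).trans τ, fun b => by simp [hτ]⟩

end Extend

/-! ### Ideals of minors and complementary minors -/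

section Minors

variable {R : Type u} [CommRing R]

theorem det_submatrix_mem_minorsIdeal {ι κ : Type*} {t : ℕ} (A : Matrix ι κ R)
    (f : Fin t ↪ ι) (g : Fin t ↪ κ) : (A.submatrix f g).det ∈ minorsIdeal t A :=
  Ideal.subset_span ⟨f, g, rfl⟩

theorem det_submatrix_equiv_mem {ι : Type*} {r : ℕ} (A : Matrix ι (Fin r) R) (f : Fin r ↪ ι) :
    (A.submatrix f id).det ∈ minorsIdeal r A :=
  det_submatrix_mem_minorsIdeal A f (Function.Embedding.refl _)

theorem minorsIdeal_le {ι κ : Type*} {t : ℕ} {A : Matrix ι κ R} {J : Ideal R}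
    (h : ∀ (f : Fin t ↪ ι) (g : Fin t ↪ κ), (A.submatrix f g).det ∈ J) : minorsIdeal t A ≤ J := by
  refine Ideal.span_le.2 ?_
  rintro _ ⟨f, g, rfl⟩
  exact h f g

theorem minorsIdeal_submatrix_le {ι κ ι' κ' : Type*} (t : ℕ) (A : Matrix ι κ R) (f : ι' ↪ ι)
    (g : κ' ↪ κ) : minorsIdeal t (A.submatrix f g) ≤ minorsIdeal t A :=
  minorsIdeal_le fun f' g' => det_submatrix_mem_minorsIdeal A (f'.trans f) (g'.trans g)

/-- For a matrix with `r` columns, the permutation of the columns of a maximal minor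
is irrelevant. -/
theorem minorsIdeal_le_of_cols {ι : Type*} {r : ℕ} {A : Matrix ι (Fin r) R} {J : Ideal R}
    (h : ∀ f : Fin r ↪ ι, (A.submatrix f id).det ∈ J) : minorsIdeal r A ≤ J := by
  refine minorsIdeal_le fun f g => ?_
  let π : Equiv.Perm (Fin r) := Equiv.ofBijective g (Finite.injective_iff_bijective.1 g.injective)
  have : (A.submatrix f g).det = Equiv.Perm.sign π * (A.submatrix f id).det := by
    rw [← Matrix.det_permute']
    rfl
  rw [this]
  exact Ideal.mul_mem_left _ _ (h f)

theorem minorsIdeal_le_of_rows {ι : Type*} {r : ℕ} {A : Matrix (Fin r) ι R} {J : Ideal R}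
    (h : ∀ f : Fin r ↪ ι, (A.submatrix id f).det ∈ J) : minorsIdeal r A ≤ J := by
  refine minorsIdeal_le fun g f => ?_
  let π : Equiv.Perm (Fin r) := Equiv.ofBijective g (Finite.injective_iff_bijective.1 g.injective)
  have : (A.submatrix g f).det = Equiv.Perm.sign π * (A.submatrix id f).det := by
    rw [← Matrix.det_permute]
    rfl
  rw [this]
  exact Ideal.mul_mem_left _ _ (h f)

/-- Expansion of a determinant along some of its columns. -/
theorem det_mem_minorsIdeal_cols {ι β : Type*} [Fintype β] [DecidableEq β] [Fintype ι]
    [DecidableEq ι] {r : ℕ} (X : Matrix ι (Fin r ⊕ β) R) (σ : Fin r ⊕ β ≃ ι) :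
    (X.submatrix σ id).det ∈ minorsIdeal r (X.submatrix id Sum.inl) := by
  let f : (ι → R) [⋀^(Fin r ⊕ β)]→ₗ[R] R :=
    (Matrix.detRowAlternating (n := Fin r ⊕ β) (R := R)).compLinearMap
      (LinearMap.funLeft R R σ)
  have hf (w : Fin r ⊕ β → ι → R) : f w = ((Matrix.of w).transpose.submatrix σ id).det := by
    rw [← Matrix.det_transpose]
    rfl
  have h1 := apply_mem_span_single (fixLeft f fun j i => X i (Sum.inl j))
    fun j i => X i (Sum.inr j)
  have h2 : (X.submatrix σ id).det = fixLeft f (fun j i => X i (Sum.inl j))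
      (fun j i => X i (Sum.inr j)) := by
    change _ = f _
    rw [hf]
    congr 1
    ext i (j | j) <;> simp
  rw [h2]
  refine Ideal.span_le.2 ?_ h1
  rintro _ ⟨s, rfl⟩
  obtain ⟨τ, hτ⟩ := exists_equiv_extending_inr (α := Fin r) (β := β) (ι := ι)
    (by rw [← Fintype.card_sum]; exact (Fintype.card_congr σ).symm) s
  change f _ ∈ _
  rw [hf]
  set Y := (Matrix.of (Sum.elim (fun j i => X i (Sum.inl j))
    (fun j => (Pi.single (s j) 1 : ι → R)))).transpose with hY
  have h3 : (Y.submatrix σ id).det =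
      Equiv.Perm.sign (σ.trans τ.symm) * (Y.submatrix τ id).det := by
    rw [← Matrix.det_permute]
    congr 1
    ext i j
    simp
  -- With the rows enumerated by `τ`, the unit vectors form an identity block, and what is left of
  -- the determinant is an r × r minor of the first columns.
  have h4 : Y.submatrix τ id = Matrix.fromBlocks (X.submatrix (fun j => τ (Sum.inl j)) Sum.inl) 0
      (X.submatrix (fun j => τ (Sum.inr j)) Sum.inl) 1 := by
    ext (i | i) (j | j)
    · simp [hY]
    · simp [hY, ← hτ]
    · simp [hY]
    · simp [hY, ← hτ, Pi.single_apply, Matrix.one_apply]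
  rw [h3, h4, Matrix.det_fromBlocks_zero₁₂, Matrix.det_one, mul_one]
  exact Ideal.mul_mem_left _ _ (det_submatrix_equiv_mem (X.submatrix id Sum.inl)
    ⟨fun j => τ (Sum.inl j), fun a b hab => by simpa using hab⟩)

/-- A weak form of Cauchy–Binet: the determinant is alternating in the columns of `W`, so unit
vectors suffice, and these select columns of `G`. -/
theorem det_mul_mem_minorsIdeal {ι : Type*} [Fintype ι] {e : ℕ} (G : Matrix (Fin e) ι R)
    (W : Matrix ι (Fin e) R) : (G * W).det ∈ minorsIdeal e G := by
  classical
  let f : (ι → R) [⋀^Fin e]→ₗ[R] R :=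
    (Matrix.detRowAlternating (n := Fin e) (R := R)).compLinearMap G.mulVecLin
  have hf (V : Fin e → ι → R) : f V = (G * (Matrix.of V).transpose).det := by
    rw [← Matrix.det_transpose]
    rfl
  have h := apply_mem_span_single f fun j i => W i j
  have h2 : (G * W).det = f fun j i => W i j := by
    rw [hf]
    rfl
  rw [h2]
  refine Ideal.span_le.2 ?_ h
  rintro _ ⟨s, rfl⟩
  change f _ ∈ _
  rw [hf]
  have h3 : G * (Matrix.of fun j => (Pi.single (s j) 1 : ι → R)).transpose =
      G.submatrix (Function.Embedding.refl _) s := by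
    ext i j
    simp [Matrix.mul_apply, Pi.single_apply]
  rw [h3]
  exact det_submatrix_mem_minorsIdeal G (Function.Embedding.refl _) s

/-- The sign of the reordering between two enumerations. -/
abbrev relSign {α ι : Type*} [Fintype α] [DecidableEq α] (σ τ : α ≃ ι) : ℤˣ :=
  Equiv.Perm.sign (τ.trans σ.symm)

theorem relSign_mul_self_cast {α ι : Type*} [Fintype α] [DecidableEq α] (σ τ : α ≃ ι) :
    ((relSign σ τ : ℤ) : R) * ((relSign σ τ : ℤ) : R) = 1 := by
  rw [← Int.cast_mul, ← Units.val_mul, Int.units_mul_self]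
  simp

/-- Complementary minors of two matrices with `G * ρ = 0` are proportional. -/
theorem complementary_minors {ι : Type*} [Fintype ι] {r e : ℕ}
    {G : Matrix (Fin e) ι R} {ρ : Matrix ι (Fin r) R} (h : G * ρ = 0)
    (σ τ τ' : Fin r ⊕ Fin e ≃ ι) :
    (G.submatrix id fun j => τ (Sum.inr j)).det *
        (relSign σ τ' * (ρ.submatrix (fun j => τ' (Sum.inl j)) id).det) =
      relSign σ τ * (ρ.submatrix (fun j => τ (Sum.inl j)) id).det *
        (G.submatrix id fun j => τ' (Sum.inr j)).det := by
  classical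
  -- Bordering `ρ` with the unit vectors complementary to `τ'`, and `G` with those of `τ`, gives
  -- square matrices. The determinant of `X * N` is computed from its block triangular form and as a
  -- product; comparing the two gives the identity.
  let w : Matrix ι (Fin e) R := (1 : Matrix ι ι R).submatrix id fun j => τ' (Sum.inr j)
  let N := Matrix.fromCols ρ w
  let X := Matrix.fromRows ((1 : Matrix ι ι R).submatrix (fun j => τ (Sum.inl j)) id) G
  have hsign (υ : Fin r ⊕ Fin e ≃ ι) :
      (N.submatrix υ id).det = relSign σ υ * (N.submatrix σ id).det := by
    rw [relSign, ← Matrix.det_permute]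
    congr 1
    ext i j
    simp
  have h1 : X * N = Matrix.fromBlocks (ρ.submatrix (fun j => τ (Sum.inl j)) id)
      (w.submatrix (fun j => τ (Sum.inl j)) id) 0
      (G.submatrix id fun j => τ' (Sum.inr j)) := by
    rw [Matrix.fromRows_mul_fromCols, h]
    congr 1
    · ext i j; simp [Matrix.mul_apply, Matrix.one_apply]
    · ext i j; simp [Matrix.mul_apply, Matrix.one_apply]
    · ext i j; simp [w, Matrix.mul_apply, Matrix.one_apply]
  have h2 : X * N = X.submatrix id τ * N.submatrix τ id := by
    rw [Matrix.submatrix_mul_equiv, Matrix.submatrix_id_id]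
  have h3 : X.submatrix id τ = Matrix.fromBlocks 1 0 (G.submatrix id fun j => τ (Sum.inl j))
      (G.submatrix id fun j => τ (Sum.inr j)) := by
    ext (i | i) (j | j) <;> simp [X, Matrix.one_apply]
  have h4 : N.submatrix τ' id = Matrix.fromBlocks (ρ.submatrix (fun j => τ' (Sum.inl j)) id) 0
      (ρ.submatrix (fun j => τ' (Sum.inr j)) id) 1 := by
    ext (i | i) (j | j) <;> simp [N, w, Matrix.one_apply]
  have h5 := congrArg Matrix.det (h1.symm.trans h2)
  rw [Matrix.det_fromBlocks_zero₂₁, Matrix.det_mul, h3, Matrix.det_fromBlocks_zero₁₂,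
    Matrix.det_one, one_mul, hsign] at h5
  have h6 := congrArg Matrix.det h4
  rw [Matrix.det_fromBlocks_zero₁₂, Matrix.det_one, mul_one, hsign] at h6
  rw [← h6, mul_assoc, h5]
  linear_combination (G.submatrix id fun j => τ (Sum.inr j)).det * (N.submatrix σ id).det *
    (relSign_mul_self_cast (R := R) σ τ' - relSign_mul_self_cast (R := R) σ τ)

/-- One index set, the enumerations `τ`, serves for the minors of `ρ` and for the complementary
minors of `G`, so that the two families of generators can be compared term by term. -/
theorem minorsIdeal_eq_span_inl {ι : Type*} [Fintype ι] {r e : ℕ} (ρ : Matrix ι (Fin r) R)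
    (σ : Fin r ⊕ Fin e ≃ ι) :
    minorsIdeal r ρ = Ideal.span (Set.range fun τ : Fin r ⊕ Fin e ≃ ι =>
      (relSign σ τ : R) * (ρ.submatrix (fun j => τ (Sum.inl j)) id).det) := by
  apply le_antisymm
  · refine minorsIdeal_le_of_cols fun f => ?_
    obtain ⟨τ, hτ⟩ := exists_equiv_extending_inl (α := Fin r) (β := Fin e)
      (by rw [← Fintype.card_sum]; exact (Fintype.card_congr σ).symm) f
    have h : (ρ.submatrix f id).det = (relSign σ τ : R) *
        ((relSign σ τ : R) * (ρ.submatrix (fun j => τ (Sum.inl j)) id).det) := by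
      rw [← mul_assoc, relSign_mul_self_cast, one_mul]
      congr 2
      ext j
      exact (hτ j).symm
    rw [h]
    exact Ideal.mul_mem_left _ _ (Ideal.subset_span ⟨τ, rfl⟩)
  · refine Ideal.span_le.2 ?_
    rintro _ ⟨τ, rfl⟩
    exact Ideal.mul_mem_left _ _ (det_submatrix_equiv_mem ρ
      ⟨fun j => τ (Sum.inl j), fun a b hab => by simpa using hab⟩)

theorem minorsIdeal_eq_span_inr {ι : Type*} [Fintype ι] {r e : ℕ} (G : Matrix (Fin e) ι R)
    (σ : Fin r ⊕ Fin e ≃ ι) :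
    minorsIdeal e G = Ideal.span (Set.range fun τ : Fin r ⊕ Fin e ≃ ι =>
      (G.submatrix id fun j => τ (Sum.inr j)).det) := by
  apply le_antisymm
  · refine minorsIdeal_le_of_rows fun f => ?_
    obtain ⟨τ, hτ⟩ := exists_equiv_extending_inr (α := Fin r) (β := Fin e)
      (by rw [← Fintype.card_sum]; exact (Fintype.card_congr σ).symm) f
    refine Ideal.subset_span ⟨τ, ?_⟩
    simp only
    congr 2
    ext j
    exact hτ j
  · refine Ideal.span_le.2 ?_
    rintro _ ⟨τ, rfl⟩
    exact det_submatrix_mem_minorsIdeal G (Function.Embedding.refl _)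
      ⟨fun j => τ (Sum.inr j), fun a b hab => by simpa using hab⟩

end Minors

/-! ### Isomorphism of proportional ideals -/

section Iso

variable {R : Type u} [CommRing R]

theorem nonempty_equiv_of_mul_eq {J J' : Ideal R} {v δ : R} (hv : v ∈ R⁰) (hδ : δ ∈ R⁰)
    (h : Ideal.span {v} * J = Ideal.span {δ} * J') : Nonempty (J ≃ₗ[R] J') := by
  have key (K : Ideal R) (a : R) (ha : a ∈ R⁰) :
      Nonempty (K ≃ₗ[R] (Ideal.span {a} * K : Ideal R)) := by
    have hinj : Function.Injective (LinearMap.mulLeft R a) := fun x y hxy =>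
      (mul_cancel_left_mem_nonZeroDivisors ha).1 (by simpa using hxy)
    refine ⟨(Submodule.equivMapOfInjective _ hinj K).trans (LinearEquiv.ofEq _ _ ?_)⟩
    ext x
    simp [Ideal.mem_span_singleton_mul]
  obtain ⟨f⟩ := key J v hv
  obtain ⟨g⟩ := key J' δ hδ
  exact ⟨f.trans ((LinearEquiv.ofEq _ _ h).trans g.symm)⟩

/-- Both ideals become equal after multiplication by `v` and `δ`. Regularity of `δ` is automatic: it
divides `v * u`, where `u` is a non-zero-divisor in the first ideal. -/
theorem nonempty_equiv_of_span_range {ι : Type*} {a b : ι → R} {v δ : R} (hv : v ∈ R⁰)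
    (ha : ∃ u ∈ Ideal.span (Set.range a), u ∈ R⁰) (h : ∀ i, v * a i = δ * b i) :
    Nonempty (Ideal.span (Set.range a) ≃ₗ[R] Ideal.span (Set.range b)) := by
  have h1 : Ideal.span {v} * Ideal.span (Set.range a) =
      Ideal.span {δ} * Ideal.span (Set.range b) := by
    rw [Ideal.span_mul_span', Ideal.span_mul_span', Set.singleton_mul, Set.singleton_mul,
      ← Set.range_comp, ← Set.range_comp]
    congr 2
    ext i
    exact h i
  refine nonempty_equiv_of_mul_eq hv ?_ h1
  obtain ⟨u, hu, hu0⟩ := ha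
  have h2 : v * u ∈ Ideal.span {δ} * Ideal.span (Set.range b) := by
    rw [← h1]
    exact Ideal.mul_mem_mul (Ideal.mem_span_singleton_self v) hu
  obtain ⟨c, -, hc⟩ := Ideal.mem_span_singleton_mul.1 h2
  have h3 : δ * c ∈ R⁰ := hc ▸ mul_mem hv hu0
  exact (mul_mem_nonZeroDivisors.1 h3).1

/-- If `G * ρ = 0` and the ideals of maximal minors contain non-zero-divisors, then these ideals
are isomorphic. -/
theorem nonempty_minorsIdeal_equiv {ι : Type*} [Fintype ι] {r e : ℕ} {G : Matrix (Fin e) ι R}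
    {ρ : Matrix ι (Fin r) R} (h : G * ρ = 0) (σ : Fin r ⊕ Fin e ≃ ι)
    (hG : ∃ v ∈ minorsIdeal e G, v ∈ R⁰) (hρ : ∃ u ∈ minorsIdeal r ρ, u ∈ R⁰) :
    Nonempty (minorsIdeal r ρ ≃ₗ[R] minorsIdeal e G) := by
  classical
  obtain ⟨v, hv, hv0⟩ := hG
  rw [minorsIdeal_eq_span_inr G σ] at hv ⊢
  rw [minorsIdeal_eq_span_inl ρ σ] at hρ ⊢
  obtain ⟨c, hc⟩ := (Submodule.mem_span_range_iff_exists_fun R).1 hv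
  -- `δ` is the combination of the minors of `ρ` with the coefficients that express `v` by the
  -- minors of `G`.
  refine nonempty_equiv_of_span_range (v := v)
    (δ := ∑ τ, c τ * (relSign σ τ * (ρ.submatrix (fun j => τ (Sum.inl j)) id).det))
    hv0 hρ fun τ' => ?_
  rw [← hc, Finset.sum_mul, Finset.sum_mul]
  refine Finset.sum_congr rfl fun τ _ => ?_
  rw [smul_eq_mul, mul_assoc, complementary_minors h σ τ τ']
  ring

end Iso

/-! ### Positive grade and non-zero-divisors -/

section Grade

variable {R : Type u} [CommRing R]

theorem one_le_idealGrade_iff {I : Ideal R} : 1 ≤ idealGrade I ↔ ∃ u ∈ I, u ∈ R⁰ := by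
  constructor
  · intro h
    have h0 : (0 : ℕ∞) < idealGrade I := lt_of_lt_of_le (by norm_num) h
    obtain ⟨⟨rs, hrs, hreg⟩, hlt⟩ := lt_iSup_iff.1 h0
    match rs, hrs, hreg, hlt with
    | [], _, _, hlt => simp at hlt
    | a :: l, hrs, hreg, _ =>
      refine ⟨a, hrs a (by simp), ?_⟩
      have := ((RingTheory.Sequence.isWeaklyRegular_cons_iff R a l).1 hreg).1
      rw [mem_nonZeroDivisors_iff_right]
      intro x hx
      exact this (by simpa [mul_comm] using hx)
  · rintro ⟨u, hu, hu0⟩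
    have hreg : IsSMulRegular R u := fun x y hxy =>
      (mul_cancel_left_mem_nonZeroDivisors hu0).1 (by simpa using hxy)
    refine le_trans ?_ (le_iSup (fun rs : {rs : List R // (∀ r ∈ rs, r ∈ I) ∧
      RingTheory.Sequence.IsWeaklyRegular R rs} => (rs.1.length : ℕ∞)) ⟨[u], ?_, ?_⟩)
    · simp
    · simpa using hu
    · rw [RingTheory.Sequence.isWeaklyRegular_cons_iff]
      exact ⟨hreg, RingTheory.Sequence.IsWeaklyRegular.nil _ _⟩

end Grade

/-! ### Determinants of injective square matrices -/

section McCoy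

variable {R : Type u} [CommRing R]

/-- Otherwise the determinant lies in an associated prime p = Ann(s). Over the domain R/p the matrix
has a nonzero kernel vector; a lift of it, multiplied by s, is a nonzero kernel vector over R. -/
theorem det_mem_nonZeroDivisors_of_mulVec_injective [IsNoetherianRing R] {n : Type*} [Fintype n]
    [DecidableEq n] (B : Matrix n n R) (hB : ∀ v, B.mulVec v = 0 → v = 0) : B.det ∈ R⁰ := by
  by_contra hdet
  have hmem : B.det ∈ ⋃ p ∈ associatedPrimes R R, (p : Set R) := by
    rw [biUnion_associatedPrimes_eq_compl_nonZeroDivisors]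
    exact hdet
  simp only [Set.mem_iUnion] at hmem
  obtain ⟨p, hp, hd⟩ := hmem
  obtain ⟨hp, s, hs⟩ := isAssociatedPrime_iff.1 hp
  have hps (a : R) : a ∈ p ↔ a * s = 0 := by
    rw [hs, Submodule.mem_colon_singleton, Submodule.mem_bot, smul_eq_mul]
  let q := Ideal.Quotient.mk p
  have h0 : (B.map q).det = 0 := by
    have := RingHom.map_det q B
    rw [RingHom.mapMatrix_apply] at this
    rw [← this]
    exact Ideal.Quotient.eq_zero_iff_mem.2 hd
  obtain ⟨w, hw, hBw⟩ := Matrix.exists_mulVec_eq_zero_iff.2 h0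
  choose v hv using fun i => Ideal.Quotient.mk_surjective (w i)
  have h2 : ∀ i, B.mulVec v i ∈ p := fun i => by
    rw [← Ideal.Quotient.eq_zero_iff_mem]
    have := congrFun hBw i
    simp only [Matrix.mulVec, dotProduct, Matrix.map_apply, Pi.zero_apply, ← hv] at this ⊢
    rw [map_sum]
    simpa using this
  have h3 : B.mulVec (s • v) = 0 := by
    rw [Matrix.mulVec_smul]
    ext i
    simpa [mul_comm] using (hps _).1 (h2 i)
  apply hw
  ext i
  rw [← hv]
  apply Ideal.Quotient.eq_zero_iff_mem.2
  have := congrFun (hB _ h3) i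
  exact (hps _).2 (by simpa [mul_comm] using this)

end McCoy

/-! ### The ideal det_f in terms of generators -/

section DetIdeal

variable {R : Type u} [CommRing R] {M : Type v} [AddCommGroup M] [Module R M] {e : ℕ}

theorem detIdeal_eq_span (f : M →ₗ[R] (Fin e → R)) :
    detIdeal f = Ideal.span (Set.range fun m : Fin e → M =>
      (Matrix.of fun j => f (m j)).det) := by
  rw [detIdeal, LinearMap.range_eq_map, ← exteriorPower.ιMulti_span, Submodule.map_span,
    ← Set.range_comp]
  congr 2
  ext m
  simp only [Function.comp_apply, LinearMap.comp_apply, exteriorPower.map_apply_ιMulti,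
    exteriorPower.alternatingMapLinearEquiv_apply_ιMulti]
  rfl

theorem detIdeal_eq_minorsIdeal {ι : Type*} [Fintype ι] (f : M →ₗ[R] (Fin e → R)) {x : ι → M}
    (hx : Submodule.span R (Set.range x) = ⊤) :
    detIdeal f = minorsIdeal e (Matrix.of fun i l => f (x l) i) := by
  rw [detIdeal_eq_span]
  apply le_antisymm
  · refine Ideal.span_le.2 ?_
    rintro _ ⟨m, rfl⟩
    have hm : ∀ j, ∃ c : ι → R, ∑ l, c l • x l = m j := fun j =>
      (Submodule.mem_span_range_iff_exists_fun R).1 (hx ▸ Submodule.mem_top)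
    choose c hc using hm
    have h := det_mul_mem_minorsIdeal (Matrix.of fun i l => f (x l) i) (Matrix.of c).transpose
    have h2 : (Matrix.of fun j => f (m j)).transpose =
        (Matrix.of fun i l => f (x l) i) * (Matrix.of c).transpose := by
      ext i j
      simp [Matrix.mul_apply, ← hc, mul_comm]
    rw [← h2, Matrix.det_transpose] at h
    exact h
  · refine minorsIdeal_le_of_rows fun s => ?_
    refine Ideal.subset_span ⟨fun j => x (s j), ?_⟩
    simp only
    rw [← Matrix.det_transpose]
    rfl

end DetIdeal

/-! ### Modules of rank e, their coordinates and their norm -/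

section Coordinates

/-- An alternating map in e variables pulled back to R^e is a multiple of the determinant. It
suffices to compare values on tuples of distinct basis vectors, that is, on permutations. -/
theorem alternatingMap_apply_sum {R M N : Type*} [CommRing R] [AddCommGroup M] [Module R M]
    [AddCommGroup N] [Module R N] {e : ℕ} (f : M [⋀^Fin e]→ₗ[R] N) (b : Fin e → M)
    (A : Matrix (Fin e) (Fin e) R) : f (fun j => ∑ i, A j i • b i) = A.det • f b := by
  have h : f.compLinearMap (Fintype.linearCombination R b) =
      (LinearMap.toSpanSingleton R N (f b)).compAlternatingMap
        (Matrix.detRowAlternating (n := Fin e) (R := R)) := by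
    refine Module.Basis.ext_alternating (Pi.basisFun R (Fin e)) fun v hv => ?_
    let σ : Equiv.Perm (Fin e) := Equiv.ofBijective v (Finite.injective_iff_bijective.1 hv)
    have h1 : (f.compLinearMap (Fintype.linearCombination R b)) (fun i => Pi.single (v i) 1) =
        f (b ∘ σ) := by
      simp [σ, Function.comp_def, Fintype.linearCombination_apply_single]
    have h2 : Matrix.detRowAlternating (n := Fin e) (R := R) (fun i => Pi.single (v i) 1) =
        Equiv.Perm.sign σ := by
      rw [← Matrix.det_permutation]
      change Matrix.det _ = Matrix.det _
      congr 1
      ext i j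
      simp [Pi.single_apply, σ, PEquiv.toMatrix_apply, eq_comm]
    simp only [Pi.basisFun_apply, LinearMap.compAlternatingMap_apply]
    rw [h1, h2, AlternatingMap.map_perm]
    simp [Units.smul_def, Int.cast_smul_eq_zsmul]
  exact DFunLike.congr_fun h fun j => A j

/-- The linear map `g : M → R ^ e` gives `t` times the coordinates with respect to the
family `b`; here `t` is a non-zero-divisor, `b` is linearly independent and `t M ⊆ ∑ R b_i`. -/
structure IsCoordinates {R : Type u} [CommRing R] {M : Type v} [AddCommGroup M] [Module R M]
    {e : ℕ} (g : M →ₗ[R] (Fin e → R)) (b : Fin e → M) (t : R) : Prop where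
  mem : t ∈ R⁰
  apply : ∀ i, g (b i) = Pi.single i t
  smul_eq : ∀ m, t • m = ∑ i, g m i • b i

variable {R : Type u} [CommRing R] {M : Type v} [AddCommGroup M] [Module R M] {e : ℕ}
  {g : M →ₗ[R] (Fin e → R)} {b : Fin e → M} {t : R}

theorem IsCoordinates.apply_sum (h : IsCoordinates g b t) (c : Fin e → R) :
    g (∑ i, c i • b i) = t • c := by
  ext j
  simp [h.apply, Pi.single_apply, mul_comm]

theorem eq_zero_of_smul_eq_zero {ι : Type*} (ht : t ∈ R⁰) {u : ι → R} (hu : t • u = 0) :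
    u = 0 := by
  ext i
  exact (mul_right_mem_nonZeroDivisors_eq_zero_iff ht).1
    (by rw [mul_comm]; exact congrFun hu i)

theorem IsCoordinates.eq_zero_of_sum_eq_zero (h : IsCoordinates g b t) {u : Fin e → R}
    (hu : ∑ i, u i • b i = 0) : u = 0 := by
  have h1 := h.apply_sum u
  rw [hu, map_zero] at h1
  exact eq_zero_of_smul_eq_zero h.mem h1.symm

/-- This is the proportionality of `detIdeal f` and `detIdeal g`: `f` factors through the
coordinates `g` after multiplication by `t`. -/
theorem IsCoordinates.det_smul_eq (h : IsCoordinates g b t) (f : M →ₗ[R] (Fin e → R))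
    (m : Fin e → M) :
    t ^ e * (Matrix.of fun j => f (m j)).det =
      (Matrix.of fun j => f (b j)).det * (Matrix.of fun j => g (m j)).det := by
  have h1 : t • (Matrix.of fun j => f (m j)) =
      (Matrix.of fun j => g (m j)) * (Matrix.of fun j => f (b j)) := by
    ext j i
    have := congrFun (congrArg f (h.smul_eq (m j))) i
    rw [map_smul, map_sum] at this
    simpa [Matrix.mul_apply] using this
  have h2 := congrArg Matrix.det h1
  rw [Matrix.det_smul, Matrix.det_mul, Fintype.card_fin] at h2
  rw [h2, mul_comm]

theorem IsCoordinates.det_apply (h : IsCoordinates g b t) :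
    (Matrix.of fun j => g (b j)).det = t ^ e := by
  have : (Matrix.of fun j => g (b j)) = t • (1 : Matrix (Fin e) (Fin e) R) := by
    ext i j
    simp [h.apply, Matrix.one_apply, Pi.single_apply, eq_comm]
  rw [this, Matrix.det_smul]
  simp

theorem IsCoordinates.exists_mem_detIdeal (h : IsCoordinates g b t) :
    ∃ u ∈ detIdeal g, u ∈ R⁰ := by
  refine ⟨t ^ e, ?_, pow_mem h.mem e⟩
  rw [detIdeal_eq_span, ← h.det_apply]
  exact Ideal.subset_span ⟨b, rfl⟩

theorem IsCoordinates.nonempty_detIdeal_equiv (h : IsCoordinates g b t)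
    (f : M →ₗ[R] (Fin e → R)) (hf : ∃ u ∈ detIdeal f, u ∈ R⁰) :
    Nonempty (detIdeal f ≃ₗ[R] detIdeal g) := by
  rw [detIdeal_eq_span] at hf
  rw [detIdeal_eq_span f, detIdeal_eq_span g]
  exact nonempty_equiv_of_span_range (pow_mem h.mem e) hf (h.det_smul_eq f)

theorem IsCoordinates.isLocalizedModule (h : IsCoordinates g b t) :
    IsLocalizedModule R⁰ ((Algebra.linearMap R (FractionRing R)).compLeft (Fin e) ∘ₗ g) := by
  refine ⟨fun s => ?_, fun y => ?_, fun {m m'} hm => ?_⟩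
  · have hu := IsLocalization.map_units (FractionRing R) s
    rw [Module.End.isUnit_iff]
    refine ⟨fun v w hvw => ?_, fun v => ?_⟩
    · ext i
      have := congrFun hvw i
      simp only [Module.algebraMap_end_apply, Pi.smul_apply, Algebra.smul_def] at this
      exact hu.mul_left_cancel this
    · obtain ⟨c, hc⟩ := hu.exists_right_inv
      refine ⟨fun i => c * v i, ?_⟩
      ext i
      simp only [Module.algebraMap_end_apply, Pi.smul_apply, Algebra.smul_def]
      rw [← mul_assoc, hc, one_mul]
  · obtain ⟨s, hs⟩ := IsLocalization.exist_integer_multiples_of_finite R⁰ y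
    choose c hc using hs
    -- The factor `t` in the denominator compensates for `g (∑ c i • b i) = t • c`.
    refine ⟨(∑ i, c i • b i, s * ⟨t, h.mem⟩), ?_⟩
    ext i
    simp only [LinearMap.comp_apply, h.apply_sum]
    have := hc i
    simp [Algebra.smul_def, Submonoid.smul_def] at this ⊢
    rw [this]
    ring
  · refine ⟨⟨t, h.mem⟩, ?_⟩
    have h1 : g m = g m' := by
      ext i
      exact IsFractionRing.injective R (FractionRing R) (congrFun hm i)
    change t • m = t • m'
    rw [h.smul_eq, h.smul_eq, h1]

theorem IsCoordinates.hasRank (h : IsCoordinates g b t) : HasRank R M e := by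
  have := h.isLocalizedModule
  exact ⟨(IsLocalizedModule.isBaseChange R⁰ (FractionRing R)
    ((Algebra.linearMap R (FractionRing R)).compLeft (Fin e) ∘ₗ g)).equiv⟩

theorem IsCoordinates.hasRank_range (h : IsCoordinates g b t) :
    HasRank R (LinearMap.range g) e := by
  have h1 : IsCoordinates (LinearMap.range g).subtype (fun i => ⟨g (b i), ⟨b i, rfl⟩⟩) t := by
    refine ⟨h.mem, fun i => h.apply i, fun m => Subtype.ext ?_⟩
    ext j
    simp [h.apply, Pi.single_apply, mul_comm]
  exact h1.hasRank

/-- The map on the exterior power induced by `det ∘ g`. -/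
theorem IsCoordinates.exteriorPower (h : IsCoordinates g b t) :
    IsCoordinates (e := 1) (M := ⋀[R]^e M)
      (LinearMap.pi fun _ => exteriorPower.alternatingMapLinearEquiv
          (Matrix.detRowAlternating (n := Fin e) (R := R)) ∘ₗ exteriorPower.map e g)
      (fun _ => exteriorPower.ιMulti R e b) (t ^ e) := by
  refine ⟨pow_mem h.mem e, fun i => ?_, fun w => ?_⟩
  · ext j
    rw [Subsingleton.elim i j]
    simp only [LinearMap.pi_apply, LinearMap.comp_apply, exteriorPower.map_apply_ιMulti,
      exteriorPower.alternatingMapLinearEquiv_apply_ιMulti, Pi.single_eq_same]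
    exact h.det_apply
  · have hw : w ∈ Submodule.span R (Set.range (exteriorPower.ιMulti R e (M := M))) := by
      rw [exteriorPower.ιMulti_span]
      trivial
    simp only [Finset.univ_unique, Fin.default_eq_zero, Fin.isValue, Finset.sum_const,
      Finset.card_singleton, one_smul, LinearMap.pi_apply]
    induction hw using Submodule.span_induction with
    | zero => simp
    | add x y _ _ hx hy => rw [smul_add, hx, hy, map_add, add_smul]
    | smul a x _ hx => rw [smul_comm, hx, map_smul, smul_assoc]
    | mem x hx =>
      obtain ⟨m, rfl⟩ := hx
      simp only [LinearMap.comp_apply, exteriorPower.map_apply_ιMulti,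
        exteriorPower.alternatingMapLinearEquiv_apply_ιMulti]
      have h1 := (exteriorPower.ιMulti R e (M := M)).toMultilinearMap.map_smul_univ
        (fun _ => t) m
      simp only [Finset.prod_const, Finset.card_univ, Fintype.card_fin] at h1
      rw [AlternatingMap.coe_multilinearMap] at h1
      rw [← h1]
      simp_rw [h.smul_eq]
      exact (alternatingMap_apply_sum _ b (Matrix.of fun j => g (m j)))

/-- The exterior power has rank one with coordinate det ∘ g. The trivialization of its localization
coming from this coordinate carries the image of the exterior power to the image of `detIdeal g` in
Q. -/
theorem IsCoordinates.representsNorm (h : IsCoordinates g b t) :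
    RepresentsNorm M e (detIdeal g) := by
  have hl := h.exteriorPower.isLocalizedModule
  set G := exteriorPower.alternatingMapLinearEquiv
          (Matrix.detRowAlternating (n := Fin e) (R := R)) ∘ₗ exteriorPower.map e g with hG
  let θ := (IsLocalizedModule.isBaseChange R⁰ (FractionRing R)
    ((Algebra.linearMap R (FractionRing R)).compLeft (Fin 1) ∘ₗ
      LinearMap.pi fun _ => G)).equiv.trans
    (LinearEquiv.funUnique (Fin 1) (FractionRing R) (FractionRing R))
  refine ⟨θ, ⟨?_⟩⟩
  have hinj : Function.Injective (Algebra.linearMap R (FractionRing R)) :=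
    IsFractionRing.injective R (FractionRing R)
  refine (Submodule.equivMapOfInjective _ hinj (detIdeal g)).trans (LinearEquiv.ofEq _ _ ?_)
  rw [detIdeal, normModule, ← LinearMap.range_comp]
  congr 1
  ext w
  simp [θ, IsBaseChange.equiv_tmul, G]

theorem RepresentsNorm.of_equiv {J J' : Ideal R} (h : RepresentsNorm M e J)
    (hJ : Nonempty (J' ≃ₗ[R] J)) : RepresentsNorm M e J' := by
  obtain ⟨θ, ⟨f⟩⟩ := h
  exact ⟨θ, ⟨hJ.some.trans f⟩⟩

/-- A finitely generated module of rank `e` has coordinates. -/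
theorem HasRank.exists_isCoordinates [Module.Finite R M] (h : HasRank R M e) :
    ∃ (g : M →ₗ[R] (Fin e → R)) (b : Fin e → M) (t : R), IsCoordinates g b t := by
  classical
  obtain ⟨θ⟩ := h
  let Q := FractionRing R
  let mk : M →ₗ[R] Q ⊗[R] M := TensorProduct.mk R Q M 1
  let φ : M →ₗ[R] (Fin e → Q) := (θ.toLinearMap.restrictScalars R) ∘ₗ mk
  let ι : (Fin e → R) →ₗ[R] (Fin e → Q) := (Algebra.linearMap R Q).compLeft (Fin e)
  have hι : Function.Injective ι := fun x y hxy => by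
    ext i
    exact IsFractionRing.injective R Q (congrFun hxy i)
  -- a common denominator
  obtain ⟨n, y, hy⟩ := Module.Finite.exists_fin (R := R) (M := M)
  obtain ⟨t₀, ht₀⟩ := IsLocalization.exist_integer_multiples_of_finite R⁰
    (fun p : Fin n × Fin e => φ (y p.1) p.2)
  have hrange : ∀ m, ((t₀ : R) • φ) m ∈ LinearMap.range ι := by
    intro m
    have hm : m ∈ Submodule.span R (Set.range y) := hy ▸ Submodule.mem_top
    rw [← Submodule.mem_comap]
    refine Submodule.span_le.2 ?_ hm
    rintro _ ⟨l, rfl⟩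
    choose c hc using fun i => ht₀ (l, i)
    exact ⟨c, funext fun i => by simpa [ι] using hc i⟩
  let G : M →ₗ[R] (Fin e → R) :=
    (LinearEquiv.ofInjective ι hι).symm.toLinearMap ∘ₗ
      ((t₀ : R) • φ).codRestrict (LinearMap.range ι) hrange
  have hG : ∀ m, ι (G m) = (t₀ : R) • φ m := fun m =>
    congrArg Subtype.val ((LinearEquiv.ofInjective ι hι).apply_symm_apply
      (((t₀ : R) • φ).codRestrict (LinearMap.range ι) hrange m))
  -- a basis coming from `M`
  choose p hp using fun i => IsLocalizedModule.surj R⁰ mk (θ.symm (Pi.single i 1))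
  let s : R⁰ := ∏ i, (p i).2
  let b : Fin e → M := fun i => (∏ j ∈ Finset.univ.erase i, (p j).2 : R⁰) • (p i).1
  have hb : ∀ i, φ (b i) = (s : R) • (Pi.single i 1 : Fin e → Q) := by
    intro i
    have h1 : mk (b i) = s • θ.symm (Pi.single i 1) := by
      simp only [b]
      rw [Submonoid.smul_def, map_smul, ← hp, ← Submonoid.smul_def, smul_smul,
        Finset.prod_erase_mul _ _ (Finset.mem_univ i)]
    simp only [φ, LinearMap.comp_apply, h1, Submonoid.smul_def, map_smul]
    simp
  -- `L` measures how far `G` is from giving coordinates. Its range is finitely generated and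
  -- vanishes in Q ⊗ M, so a single non-zero-divisor `c` kills it, and rescaling `G` by `c`
  -- suffices.
  let L : M →ₗ[R] M := ((s : R) * t₀) • LinearMap.id - Fintype.linearCombination R b ∘ₗ G
  have hL : ∀ m, mk (L m) = 0 := by
    intro m
    have : φ (L m) = 0 := by
      simp only [L, LinearMap.sub_apply, LinearMap.smul_apply, LinearMap.id_apply, map_sub,
        map_smul, LinearMap.comp_apply, Fintype.linearCombination_apply, map_sum, hb]
      ext i
      have := congrFun (hG m) i
      simp [ι] at this
      simp [Algebra.smul_def, Pi.single_apply, this]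
      ring
    simpa [φ] using this
  have htors : Module.IsTorsion R (LinearMap.range L) := by
    rintro ⟨_, m, rfl⟩
    obtain ⟨c, hc⟩ := (IsLocalizedModule.eq_zero_iff R⁰ mk).1 (hL m)
    exact ⟨c, Subtype.ext hc⟩
  obtain ⟨c, hc, hc0⟩ := Submodule.annihilator_top_inter_nonZeroDivisors htors
  have hcL : ∀ m, c • L m = 0 := fun m =>
    congrArg Subtype.val ((Submodule.mem_annihilator.1 hc) ⟨L m, m, rfl⟩ trivial)
  refine ⟨c • G, b, c * (s * t₀), mul_mem hc0 (mul_mem s.2 t₀.2), fun i => ?_, fun m => ?_⟩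
  · apply hι
    rw [LinearMap.smul_apply, map_smul, hG, hb]
    ext j
    by_cases hj : j = i
    · subst hj
      simp [ι, Algebra.smul_def]
      ring
    · simp [ι, hj]
  · have := hcL m
    simp only [L, LinearMap.sub_apply, LinearMap.smul_apply, LinearMap.id_apply,
      LinearMap.comp_apply, Fintype.linearCombination_apply, smul_sub, sub_eq_zero] at this
    rw [mul_smul, this, Finset.smul_sum]
    simp [smul_smul]

/-- Independent elements of the image of `f` form a square matrix with injective transpose, whose
determinant is therefore a non-zero-divisor. -/
theorem exists_mem_detIdeal_of_hasRank_range [IsNoetherianRing R] [Module.Finite R M]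
    (f : M →ₗ[R] (Fin e → R)) (hf : HasRank R (LinearMap.range f) e) :
    ∃ u ∈ detIdeal f, u ∈ R⁰ := by
  obtain ⟨g, b, t, h⟩ := hf.exists_isCoordinates
  choose m hm using fun i => (b i).2
  let F : Matrix (Fin e) (Fin e) R := Matrix.of fun j => f (m j)
  refine ⟨F.det, ?_, ?_⟩
  · rw [detIdeal_eq_span]
    exact Ideal.subset_span ⟨m, rfl⟩
  · rw [← Matrix.det_transpose]
    refine det_mem_nonZeroDivisors_of_mulVec_injective _ fun v hv => ?_
    have h1 : ∑ i, v i • b i = 0 := by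
      apply Subtype.ext
      ext j
      have := congrFun hv j
      simpa [Matrix.mulVec, dotProduct, F, hm, mul_comm] using this
    exact h.eq_zero_of_sum_eq_zero h1

end Coordinates

/-! ### Flat base change of coordinates and of det_f -/

section BaseChange

variable {R : Type u} [CommRing R] {M : Type v} [AddCommGroup M] [Module R M] {e : ℕ}
  (S : Type w) [CommRing S] [Algebra R S]

/-- The base change of a map `M → R ^ e`. -/
noncomputable def coordBaseChange (f : M →ₗ[R] (Fin e → R)) : S ⊗[R] M →ₗ[S] (Fin e → S) :=
  (TensorProduct.piScalarRight R S S (Fin e)).toLinearMap ∘ₗ f.baseChange S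

@[simp]
theorem coordBaseChange_tmul (f : M →ₗ[R] (Fin e → R)) (s : S) (m : M) (i : Fin e) :
    coordBaseChange S f (s ⊗ₜ m) i = s * algebraMap R S (f m i) := by
  simp [coordBaseChange, Algebra.smul_def, mul_comm]

theorem algebraMap_mem_nonZeroDivisors [Module.Flat R S] {t : R} (ht : t ∈ R⁰) :
    algebraMap R S t ∈ S⁰ := by
  have h1 : IsSMulRegular R t := fun x y hxy =>
    (mul_cancel_left_mem_nonZeroDivisors ht).1 (by simpa using hxy)
  have h2 : IsSMulRegular S (algebraMap R S t) := h1.of_flat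
  rw [mem_nonZeroDivisors_iff_right]
  intro x hx
  exact h2 (by simpa [mul_comm] using hx)

theorem IsCoordinates.baseChange [Module.Flat R S] {g : M →ₗ[R] (Fin e → R)} {b : Fin e → M}
    {t : R} (h : IsCoordinates g b t) :
    IsCoordinates (coordBaseChange S g) (fun i => (1 : S) ⊗ₜ[R] b i) (algebraMap R S t) := by
  refine ⟨algebraMap_mem_nonZeroDivisors S h.mem, fun i => ?_, fun m => ?_⟩
  · ext j
    simp [h.apply, Pi.single_apply, apply_ite (algebraMap R S)]
  · induction m with
    | zero => simp
    | add x y hx hy => simp [smul_add, hx, hy, add_smul, Finset.sum_add_distrib]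
    | tmul s m =>
      rw [algebraMap_smul, ← TensorProduct.tmul_smul, h.smul_eq, TensorProduct.tmul_sum]
      refine Finset.sum_congr rfl fun i _ => ?_
      rw [coordBaseChange_tmul, TensorProduct.smul_tmul', smul_eq_mul, mul_one,
        TensorProduct.tmul_smul, TensorProduct.smul_tmul', Algebra.smul_def, mul_comm]

theorem span_range_one_tmul {ι : Type*} {x : ι → M}
    (hx : Submodule.span R (Set.range x) = ⊤) :
    Submodule.span S (Set.range fun i => (1 : S) ⊗ₜ[R] x i) = ⊤ := by
  rw [eq_top_iff]
  rintro m -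
  induction m with
  | zero => exact zero_mem _
  | add x y hx hy => exact add_mem hx hy
  | tmul s m =>
    have hm : m ∈ Submodule.span R (Set.range x) := hx ▸ Submodule.mem_top
    induction hm using Submodule.span_induction with
    | zero => simp
    | add a b _ _ ha hb => rw [TensorProduct.tmul_add]; exact add_mem ha hb
    | smul c a _ ha =>
      rw [TensorProduct.tmul_smul, ← algebraMap_smul S c]
      exact Submodule.smul_mem _ _ ha
    | mem a ha =>
      obtain ⟨i, rfl⟩ := ha
      have : s ⊗ₜ[R] x i = s • ((1 : S) ⊗ₜ[R] x i) := by
        rw [TensorProduct.smul_tmul', smul_eq_mul, mul_one]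
      rw [this]
      exact Submodule.smul_mem _ _ (Submodule.subset_span ⟨i, rfl⟩)

theorem detIdeal_coordBaseChange [Module.Finite R M] (f : M →ₗ[R] (Fin e → R)) :
    detIdeal (coordBaseChange S f) = (detIdeal f).map (algebraMap R S) := by
  obtain ⟨n, x, hx⟩ := Module.Finite.exists_fin (R := R) (M := M)
  rw [detIdeal_eq_minorsIdeal f hx, detIdeal_eq_minorsIdeal _ (span_range_one_tmul S hx)]
  have h : (Matrix.of fun i l => coordBaseChange S f ((1 : S) ⊗ₜ[R] x l) i) =
      (Matrix.of fun i l => f (x l) i).map (algebraMap R S) := by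
    ext i l
    simp
  rw [h]
  have hdet (p : Fin e ↪ Fin e) (q : Fin e ↪ Fin n) :
      (((Matrix.of fun i l => f (x l) i).map (algebraMap R S)).submatrix p q).det =
        algebraMap R S ((Matrix.of fun i l => f (x l) i).submatrix p q).det := by
    rw [RingHom.map_det]
    rfl
  apply le_antisymm
  · refine minorsIdeal_le fun p q => ?_
    rw [hdet]
    exact Ideal.mem_map_of_mem _ (det_submatrix_mem_minorsIdeal _ p q)
  · rw [Ideal.map_le_iff_le_comap]
    refine minorsIdeal_le fun p q => ?_
    rw [Ideal.mem_comap, ← hdet]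
    exact det_submatrix_mem_minorsIdeal _ p q

end BaseChange

/-! ### Properties of the Nagata extension -/

section NagataFacts

variable (R : Type u) [CommRing R] [IsLocalRing R] (σ : Type v)

instance : Module.Flat (MvPolynomial σ R) (NagataExt R σ) :=
  IsLocalization.flat _ ((IsLocalRing.maximalIdeal R).map
    (MvPolynomial.C : R →+* MvPolynomial σ R)).primeCompl

instance : Module.Flat R (NagataExt R σ) :=
  Module.Flat.trans R (MvPolynomial σ R) (NagataExt R σ)

instance : IsLocalRing (NagataExt R σ) :=
  IsLocalization.AtPrime.isLocalRing (NagataExt R σ)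
    ((IsLocalRing.maximalIdeal R).map (MvPolynomial.C : R →+* MvPolynomial σ R))

instance [IsNoetherianRing R] [Finite σ] : IsNoetherianRing (NagataExt R σ) :=
  IsLocalization.isNoetherianRing ((IsLocalRing.maximalIdeal R).map
    (MvPolynomial.C : R →+* MvPolynomial σ R)).primeCompl _ inferInstance

variable {R σ}

theorem isUnit_algebraMap_nagataExt {f : MvPolynomial σ R} {m : σ →₀ ℕ}
    (hf : IsUnit (f.coeff m)) : IsUnit (algebraMap (MvPolynomial σ R) (NagataExt R σ) f) := by
  refine IsLocalization.map_units (M := ((IsLocalRing.maximalIdeal R).map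
    (MvPolynomial.C : R →+* MvPolynomial σ R)).primeCompl) (NagataExt R σ) ⟨f, fun h => ?_⟩
  exact (IsLocalRing.mem_maximalIdeal _).1 (MvPolynomial.mem_map_C_iff.1 h m) hf

/-- Powers of one indeterminate work: the difference of two distinct powers has a coefficient 1,
hence lies outside 𝔪R'. This provides room for avoiding primes even when the residue field of R is
finite. -/
theorem exists_seq_isUnit_sub (q : σ) :
    ∃ c : ℕ → NagataExt R σ, ∀ i j, i ≠ j → IsUnit (c i - c j) := by
  classical
  refine ⟨fun i => algebraMap (MvPolynomial σ R) _ (MvPolynomial.X q ^ i), fun i j hij => ?_⟩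
  rw [← map_sub]
  apply isUnit_algebraMap_nagataExt (m := Finsupp.single q i)
  have h : Finsupp.single q j ≠ Finsupp.single q i := fun h =>
    hij (Finsupp.single_injective q h).symm
  simp [MvPolynomial.coeff_X_pow, h]

end NagataFacts

/-! ### Relations on an ideal with maximal minors of positive grade -/

section Relations

variable {S : Type u} [CommRing S]

/-- In a Noetherian ring with sufficiently many units, two non-zero-divisor conditions can be
satisfied simultaneously. -/
theorem exists_add_mul_mem_nonZeroDivisors [IsNoetherianRing S] {c : ℕ → S}
    (hc : ∀ i j, i ≠ j → IsUnit (c i - c j)) {x y z : S} (hz : z ∈ S⁰) :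
    ∃ a, x + a ∈ S⁰ ∧ z + a * y ∈ S⁰ := by
  by_contra! hbad
  have hass (w : S) : w ∉ S⁰ → ∃ p : associatedPrimes S S, w ∈ p.1 := fun hw => by
    have : w ∈ ⋃ p ∈ associatedPrimes S S, (p : Set S) := by
      rw [biUnion_associatedPrimes_eq_compl_nonZeroDivisors]
      exact hw
    simp only [Set.mem_iUnion] at this
    obtain ⟨p, hp, h⟩ := this
    exact ⟨⟨p, hp⟩, h⟩
  have hnz (p : associatedPrimes S S) : z ∉ p.1 := fun h => by
    have : z ∈ ⋃ p ∈ associatedPrimes S S, (p : Set S) := Set.mem_biUnion p.2 h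
    rw [biUnion_associatedPrimes_eq_compl_nonZeroDivisors] at this
    exact this hz
  -- If no `c i` works, each `i` is obstructed by an associated prime and by one of the two
  -- conditions. There are finitely many such pairs, so two indices share one. Subtracting puts a
  -- unit into the prime, or else `y` and hence `z`.
  have key (i : ℕ) : ∃ q : associatedPrimes S S × Bool,
      if q.2 then x + c i ∈ q.1.1 else z + c i * y ∈ q.1.1 := by
    by_cases h : x + c i ∈ S⁰
    · obtain ⟨p, hp⟩ := hass _ (hbad _ h)
      exact ⟨(p, false), by simpa using hp⟩
    · obtain ⟨p, hp⟩ := hass _ h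
      exact ⟨(p, true), by simpa using hp⟩
  choose q hq using key
  have : Finite (associatedPrimes S S) := (associatedPrimes.finite S S).to_subtype
  obtain ⟨i, j, hij, hqij⟩ := Finite.exists_ne_map_eq_of_infinite q
  have hi := hq i
  have hj := hq j
  rw [← hqij] at hj
  have hprime : (q i).1.1.IsPrime := (q i).1.2.isPrime
  have hu := hc i j hij
  cases hb : (q i).2 with
  | true =>
    simp only [hb, if_true] at hi hj
    have h := Ideal.sub_mem _ hi hj
    rw [add_sub_add_left_eq_sub] at h
    exact hprime.ne_top (Ideal.eq_top_of_isUnit_mem _ h hu)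
  | false =>
    simp only [hb, Bool.false_eq_true, if_false] at hi hj
    have h := Ideal.sub_mem _ hi hj
    rw [add_sub_add_left_eq_sub, ← sub_mul] at h
    have hy : y ∈ (q i).1.1 := (hprime.mem_or_mem h).resolve_left fun h' =>
      hprime.ne_top (Ideal.eq_top_of_isUnit_mem _ h' hu)
    exact hnz _ ((Ideal.add_mem_iff_left _ (Ideal.mul_mem_left _ _ hy)).1 hi)

/-- Relations on the generators of an ideal of positive grade with maximal minors of
positive grade. -/
theorem exists_relations [IsNoetherianRing S] {c : ℕ → S}
    (hc : ∀ i j, i ≠ j → IsUnit (c i - c j)) {r : ℕ} (g : Fin (r + 1) → S)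
    (hg : ∃ u ∈ Ideal.span (Set.range g), u ∈ S⁰) :
    ∃ ψ : Matrix (Fin (r + 1)) (Fin r) S, (∀ j, ∑ i, ψ i j * g i = 0) ∧
      ∃ u ∈ minorsIdeal r ψ, u ∈ S⁰ := by
  obtain ⟨z, hz, hz0⟩ := hg
  obtain ⟨x, hx⟩ := (Submodule.mem_span_range_iff_exists_fun S).1 hz
  obtain ⟨a, ha1, ha2⟩ := exists_add_mul_mem_nonZeroDivisors hc (x := x 0) (y := g 0) hz0
  let y : Fin (r + 1) → S := Function.update x 0 (x 0 + a)
  have hy0 : y 0 = x 0 + a := by simp [y]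
  let w := ∑ i, y i * g i
  have hw : w = z + a * g 0 := by
    simp only [w, Fin.sum_univ_succ, ← hx, smul_eq_mul, hy0]
    simp only [y, Function.update_of_ne (Fin.succ_ne_zero _)]
    ring
  -- These are the columns of w · Id - y gᵗ other than the first. They are relations on `g` because
  -- w = ∑ y_i g_i.
  let ψ : Matrix (Fin (r + 1)) (Fin r) S :=
    Matrix.of fun i j => (if i = j.succ then w else 0) - y i * g j.succ
  refine ⟨ψ, fun j => ?_, w ^ r * y 0, ?_, ?_⟩
  · simp only [ψ, Matrix.of_apply, sub_mul, Finset.sum_sub_distrib, ite_mul, zero_mul,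
      Finset.sum_ite_eq', Finset.mem_univ, if_true, mul_right_comm,
      ← Finset.sum_mul]
    exact sub_self _
  · let X : Matrix (Fin (r + 1)) (Fin r ⊕ Unit) S := Matrix.fromCols ψ (Matrix.of fun i _ => y i)
    let σ : Fin r ⊕ Unit ≃ Fin (r + 1) :=
      ((finSuccEquiv r).trans (Equiv.optionEquivSumPUnit (Fin r))).symm
    have hσl (j : Fin r) : σ (Sum.inl j) = j.succ := by simp [σ]
    have hσr (j : Unit) : σ (Sum.inr j) = 0 := by simp [σ]
    have h := det_mem_minorsIdeal_cols X σ
    -- With the column `y` appended, column operations remove the multiples of `y` from `ψ` and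
    -- leave a triangular matrix of determinant `w ^ r * y 0`. Expansion along `y` then puts this
    -- product into the ideal of maximal minors of `ψ`.
    have h1 : X.submatrix σ id =
        Matrix.fromBlocks (w • (1 : Matrix (Fin r) (Fin r) S)) (Matrix.of fun i _ => y i.succ) 0
          (Matrix.of fun _ _ => y 0) *
        Matrix.fromBlocks 1 0 (Matrix.of fun _ j => - g j.succ) 1 := by
      rw [Matrix.fromBlocks_multiply]
      ext (i | i) (j | j)
      · simp [X, hσl, ψ, Matrix.mul_apply, Matrix.one_apply, sub_eq_add_neg]
      · simp [X, hσl]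
      · simp [X, hσr, ψ, Matrix.mul_apply, (Fin.succ_ne_zero j).symm]
      · simp [X, hσr]
    have h2 : (X.submatrix σ id).det = w ^ r * y 0 := by
      rw [h1, Matrix.det_mul, Matrix.det_fromBlocks_zero₂₁, Matrix.det_fromBlocks_zero₁₂]
      simp
    rw [h2] at h
    exact h
  · rw [hw, hy0]
    exact mul_mem (pow_mem ha2 r) ha1

end Relations

/-! ### The generic determinant and regular elements of Bourbaki ideals -/

section Generic

variable {R : Type u} [CommRing R] {E : Type v} [AddCommGroup E] [Module R E] {k d : ℕ}

/-- The generic combinations are deformed towards the independent elements `b`: after adding T times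
the coefficients of `b` to the indeterminates, the top coefficient in T of the determinant is a
power of `t`, up to one extra factor T. -/
theorem generic_det_mem_nonZeroDivisors {g : E →ₗ[R] (Fin (d + 1) → R)} {b : Fin (d + 1) → E}
    {t : R} (h : IsCoordinates g b t) (a : Fin k → E) (B : Fin (d + 1) → Fin k → R)
    (hB : ∀ i, ∑ l, B i l • a l = b i) :
    (Matrix.of (Fin.snoc (α := fun _ => Fin (d + 1) → MvPolynomial (Fin k × Fin d) R)
      (fun j i => ∑ l, MvPolynomial.X (l, j) * MvPolynomial.C (g (a l) i))
      (fun i => MvPolynomial.C (g (b (Fin.last d)) i)))).det ∈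
        (MvPolynomial (Fin k × Fin d) R)⁰ := by
  set P : Matrix (Fin (d + 1)) (Fin (d + 1)) (MvPolynomial (Fin k × Fin d) R) :=
    Matrix.of (Fin.snoc (α := fun _ => Fin (d + 1) → MvPolynomial (Fin k × Fin d) R)
      (fun j i => ∑ l, MvPolynomial.X (l, j) * MvPolynomial.C (g (a l) i))
      (fun i => MvPolynomial.C (g (b (Fin.last d)) i))) with hP
  -- The substitution z ↦ z + T B, with T the variable of the outer polynomial ring. It is injective
  -- since T = 0 recovers the identity.
  let Θ : MvPolynomial (Fin k × Fin d) R →+* Polynomial (MvPolynomial (Fin k × Fin d) R) :=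
    MvPolynomial.eval₂Hom (Polynomial.C.comp MvPolynomial.C) fun q =>
      Polynomial.C (MvPolynomial.X q) +
        Polynomial.X * Polynomial.C (MvPolynomial.C (B q.2.castSucc q.1))
  have hΘC (c : R) : Θ (MvPolynomial.C c) = Polynomial.C (MvPolynomial.C c) := by simp [Θ]
  have hΘX (q : Fin k × Fin d) : Θ (MvPolynomial.X q) = Polynomial.C (MvPolynomial.X q) +
      Polynomial.X * Polynomial.C (MvPolynomial.C (B q.2.castSucc q.1)) := by simp [Θ]
  have hΘ : (Polynomial.evalRingHom 0).comp Θ = RingHom.id _ := by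
    ext q <;> simp [Θ]
  have hΘinj : Function.Injective Θ :=
    Function.LeftInverse.injective (g := Polynomial.evalRingHom 0) (RingHom.congr_fun hΘ)
  let B₀ : Matrix (Fin (d + 1)) (Fin (d + 1)) (MvPolynomial (Fin k × Fin d) R) :=
    Matrix.of (Fin.snoc (α := fun _ => Fin (d + 1) → MvPolynomial (Fin k × Fin d) R)
      (fun j i => ∑ l, MvPolynomial.X (l, j) * MvPolynomial.C (g (a l) i)) 0)
  let A₀ : Matrix (Fin (d + 1)) (Fin (d + 1)) (MvPolynomial (Fin k × Fin d) R) :=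
    (MvPolynomial.C t : MvPolynomial (Fin k × Fin d) R) • 1
  have hgB (j i : Fin (d + 1)) : ∑ l, B j l * g (a l) i = (Pi.single j t : Fin (d + 1) → R) i := by
    rw [← h.apply, ← hB]
    simp
  -- The last row of `P` is t times a unit vector and does not involve the indeterminates; the
  -- factor T is put into this row so that all diagonal terms become T t.
  have h1 : Polynomial.X * Θ P.det =
      ((Polynomial.X : Polynomial (MvPolynomial (Fin k × Fin d) R)) • A₀.map Polynomial.C +
        B₀.map Polynomial.C).det := by
    rw [RingHom.map_det, ← Matrix.updateRow_eq_self (Θ.mapMatrix P) (Fin.last d),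
      ← Matrix.det_updateRow_smul]
    congr 1
    ext1 j i
    induction j using Fin.lastCases with
    | last =>
      by_cases hi : i = Fin.last d
      · simp [P, A₀, B₀, h.apply, hi, hΘC]
      · simp [P, A₀, B₀, h.apply, hi, Ne.symm hi]
    | cast j =>
      rw [Matrix.updateRow_ne (Fin.castSucc_lt_last j).ne]
      have h3 := congrArg (fun z => (Polynomial.C (MvPolynomial.C z) :
        Polynomial (MvPolynomial (Fin k × Fin d) R))) (hgB j.castSucc i)
      simp only [map_sum, map_mul] at h3
      have h4 : A₀ j.castSucc i = MvPolynomial.C ((Pi.single j.castSucc t : Fin (d + 1) → R) i) := by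
        by_cases hi : i = j.castSucc
        · simp [A₀, hi]
        · simp [A₀, hi, Ne.symm hi]
      rw [Matrix.add_apply, Matrix.smul_apply, Matrix.map_apply, h4, ← h3, smul_eq_mul,
        Finset.mul_sum]
      simp only [P, B₀, RingHom.mapMatrix_apply, Matrix.map_apply, Matrix.of_apply,
        Fin.snoc_castSucc, map_sum, map_mul, hΘC, hΘX, ← Finset.sum_add_distrib]
      exact Finset.sum_congr rfl fun l _ => by ring
  have h2 : Polynomial.X * Θ P.det ∈ (Polynomial (MvPolynomial (Fin k × Fin d) R))⁰ := by
    -- The coefficient of T^(d+1) is det(t · Id) = t^(d+1).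
    apply Polynomial.mem_nonzeroDivisors_of_coeff_mem (d + 1)
    rw [h1]
    have := Polynomial.coeff_det_X_add_C_card A₀ B₀
    rw [Fintype.card_fin] at this
    rw [this]
    simp only [A₀, Matrix.det_smul, Matrix.det_one, mul_one]
    exact pow_mem (algebraMap_mem_nonZeroDivisors (MvPolynomial (Fin k × Fin d) R) h.mem) _
  rw [mem_nonZeroDivisors_iff_right]
  intro q hq
  apply hΘinj
  rw [map_zero]
  refine (mem_nonZeroDivisors_iff_right.1 h2) _ ?_
  have := congrArg Θ hq
  rw [map_mul, map_zero] at this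
  rw [mul_left_comm, this, mul_zero]

/-- Since E/U is finitely generated and torsion, a single non-zero-divisor s satisfies sE ⊆ U; the
family b is rescaled by s. -/
theorem HasRank.exists_isCoordinates_mem [Module.Finite R E] {e : ℕ} (h : HasRank R E e) {U : Submodule R E}
    (hU : Module.IsTorsion R (E ⧸ U)) :
    ∃ (g : E →ₗ[R] (Fin e → R)) (b : Fin e → E) (t : R), IsCoordinates g b t ∧ ∀ i, b i ∈ U := by
  obtain ⟨g, b, t, h⟩ := h.exists_isCoordinates
  obtain ⟨s, hs, hs0⟩ := Submodule.annihilator_top_inter_nonZeroDivisors hU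
  have hsU (m : E) : s • m ∈ U := by
    rw [← Submodule.Quotient.mk_eq_zero, Submodule.Quotient.mk_smul]
    exact (Submodule.mem_annihilator.1 hs) _ trivial
  refine ⟨g, fun i => s • b i, s * t, ⟨mul_mem hs0 h.mem, fun i => ?_, fun m => ?_⟩,
    fun i => hsU _⟩
  · rw [map_smul, h.apply, ← Pi.single_smul, smul_eq_mul]
  · rw [mul_smul, h.smul_eq, Finset.smul_sum]
    exact Finset.sum_congr rfl fun i _ => smul_comm _ _ _

variable [IsLocalRing R]

/-- The functional is m ↦ det(g(x_1), …, g(x_d), g(m)), which vanishes on F because the determinant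
is alternating. -/
theorem exists_functional_genericSubmodule {g : E →ₗ[R] (Fin (d + 1) → R)} {b : Fin (d + 1) → E}
    {t : R} (h : IsCoordinates g b t) (a : Fin k → E)
    (hb : ∀ i, b i ∈ Submodule.span R (Set.range a)) :
    ∃ L : NagataExt R (Fin k × Fin d) ⊗[R] E →ₗ[NagataExt R (Fin k × Fin d)]
        NagataExt R (Fin k × Fin d),
      (∀ m ∈ genericSubmodule d a, L m = 0) ∧
        L (1 ⊗ₜ b (Fin.last d)) ∈ (NagataExt R (Fin k × Fin d))⁰ := by
  choose B hB using fun i => (Submodule.mem_span_range_iff_exists_fun R).1 (hb i)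
  let S := NagataExt R (Fin k × Fin d)
  have hS (c : R) : algebraMap R S c =
      algebraMap (MvPolynomial (Fin k × Fin d) R) S (MvPolynomial.C c) :=
    IsScalarTower.algebraMap_apply R (MvPolynomial (Fin k × Fin d) R) S c
  let D : (S ⊗[R] E) [⋀^Fin (d + 1)]→ₗ[S] S :=
    (Matrix.detRowAlternating (n := Fin (d + 1)) (R := S)).compLinearMap (coordBaseChange S g)
  let x : Fin (d + 1) → S ⊗[R] E :=
    Fin.snoc (α := fun _ => S ⊗[R] E) (fun j => genericElement a j) 0
  let L : S ⊗[R] E →ₗ[S] S := D.toMultilinearMap.toLinearMap x (Fin.last d)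
  have hL (m : S ⊗[R] E) :
      L m = D (Fin.snoc (α := fun _ => S ⊗[R] E) (fun j => genericElement a j) m) := by
    simp only [L, MultilinearMap.toLinearMap_apply, x, Fin.update_snoc_last]
    rfl
  refine ⟨L, fun m hm => ?_, ?_⟩
  · have hle : genericSubmodule d a ≤ LinearMap.ker L := by
      refine Submodule.span_le.2 ?_
      rintro _ ⟨j, rfl⟩
      rw [SetLike.mem_coe, LinearMap.mem_ker, hL]
      refine D.map_eq_zero_of_eq _ (i := j.castSucc) (j := Fin.last d) ?_
        (Fin.castSucc_lt_last j).ne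
      simp
    exact hle hm
  · have h1 := algebraMap_mem_nonZeroDivisors S (generic_det_mem_nonZeroDivisors h a B hB)
    convert h1 using 1
    rw [hL, RingHom.map_det]
    change Matrix.det _ = _
    congr 1
    ext j i
    induction j using Fin.lastCases with
    | last =>
      simp [hS]
    | cast j =>
      simp [genericElement, hS]
      rfl

variable [Module.Finite R E]

/-- A generic Bourbaki ideal contains a non-zero-divisor. -/
theorem IsGenericBourbakiIdeal.exists_mem_nonZeroDivisors {a : Fin k → E}
    {I : Ideal (NagataExt R (Fin k × Fin d))} (hrank : HasRank R E (d + 1))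
    (hI : IsGenericBourbakiIdeal (d + 1) a I) :
    ∃ u ∈ I, u ∈ (NagataExt R (Fin k × Fin d))⁰ := by
  obtain ⟨g, b, t, h, hb⟩ := hrank.exists_isCoordinates_mem hI.isTorsion
  obtain ⟨L, hL, hL0⟩ := exists_functional_genericSubmodule h a hb
  obtain ⟨θ⟩ := hI.iso
  change I ≃ₗ[NagataExt R (Fin k × Fin d)] (NagataExt R (Fin k × Fin d) ⊗[R] E) ⧸
    genericSubmodule d a at θ
  let y := θ.symm (Submodule.Quotient.mk (1 ⊗ₜ b (Fin.last d)))
  refine ⟨y, y.2, ?_⟩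
  rw [mem_nonZeroDivisors_iff_right]
  intro s hs
  have h1 : s • y = 0 := Subtype.ext hs
  rw [← map_smul, LinearEquiv.map_eq_zero_iff, ← Submodule.Quotient.mk_smul,
    Submodule.Quotient.mk_eq_zero] at h1
  have h2 := hL _ h1
  rw [map_smul, smul_eq_mul] at h2
  exact mem_nonZeroDivisors_iff_right.1 hL0 s h2

/-- Guarantees an indeterminate for `exists_seq_isUnit_sub`. For k = 0 the module E itself would be
torsion, against positive rank. -/
theorem IsGenericBourbakiIdeal.nonempty_fin {a : Fin k → E}
    {I : Ideal (NagataExt R (Fin k × Fin d))} (hrank : HasRank R E (d + 1))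
    (hI : IsGenericBourbakiIdeal (d + 1) a I) : Nonempty (Fin k) := by
  by_contra hk
  rw [not_nonempty_iff] at hk
  obtain ⟨g, b, t, h, hb⟩ := hrank.exists_isCoordinates_mem hI.isTorsion
  have h0 : b 0 = 0 := by simpa [Set.range_eq_empty] using hb 0
  have h1 := congrFun (h.apply 0) 0
  rw [h0, map_zero, Pi.single_eq_same] at h1
  exact nonZeroDivisors.ne_zero h.mem h1.symm

end Generic

/-! ### Presentations and Fitting ideals -/

section Presentation

variable {S : Type u} [CommRing S] {M : Type v} [AddCommGroup M] [Module S M]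

theorem IsPresentedBy.sum_eq_zero {ι κ : Type*} [Fintype ι] [Fintype κ] {x : ι → M}
    {φ : Matrix ι κ S} (h : IsPresentedBy x φ) (j : κ) : ∑ i, φ i j • x i = 0 := by
  classical
  have h1 : φ.mulVecLin (Pi.single j 1) ∈ LinearMap.ker (Fintype.linearCombination S x) :=
    h.range_eq_ker ▸ LinearMap.mem_range_self _ _
  simpa [Fintype.linearCombination_apply] using h1

theorem IsPresentedBy.exists_mul_eq {ι κ κ' : Type*} [Fintype ι] [Fintype κ] {x : ι → M}
    {φ : Matrix ι κ S} (h : IsPresentedBy x φ) (W : Matrix ι κ' S)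
    (hW : ∀ j, ∑ i, W i j • x i = 0) : ∃ C : Matrix κ κ' S, φ * C = W := by
  have h1 (j : κ') : ∃ c, φ.mulVecLin c = fun i => W i j := by
    rw [← LinearMap.mem_range, h.range_eq_ker]
    simpa [Fintype.linearCombination_apply] using hW j
  choose c hc using h1
  refine ⟨(Matrix.of c).transpose, ?_⟩
  ext i j
  exact congrFun (hc j) i

theorem exists_matrix_sum_eq {ι κ : Type*} [Fintype ι] {x : ι → M}
    (hx : Submodule.span S (Set.range x) = ⊤) (y : κ → M) :
    ∃ A : Matrix ι κ S, ∀ j, ∑ i, A i j • x i = y j := by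
  have h (j : κ) := (Submodule.mem_span_range_iff_exists_fun S).1
    (hx ▸ Submodule.mem_top : y j ∈ Submodule.span S (Set.range x))
  choose c hc using h
  exact ⟨(Matrix.of c).transpose, hc⟩

theorem sum_mul_smul {ι κ κ' : Type*} [Fintype ι] [Fintype κ] {x : ι → M} {y : κ → M}
    {A : Matrix ι κ S} (hA : ∀ j, ∑ i, A i j • x i = y j) (B : Matrix κ κ' S) (l : κ') :
    ∑ i, (A * B) i l • x i = ∑ j, B j l • y j := by
  simp only [Matrix.mul_apply, Finset.sum_smul, ← hA, Finset.smul_sum, smul_smul]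
  rw [Finset.sum_comm]
  exact Finset.sum_congr rfl fun j _ => Finset.sum_congr rfl fun i _ => by rw [mul_comm]

theorem IsPresentedBy.minorsIdeal_le_fittingIdeal {ι : Type*} [Fintype ι] {m n r e : ℕ}
    {x : ι → M} {φ : Matrix ι (Fin m) S} (h : IsPresentedBy x φ) (ε : Fin n ≃ ι)
    (hn : n - e = r) : minorsIdeal r φ ≤ fittingIdeal S M e := by
  subst hn
  have h1 : IsPresentedBy (x ∘ ε) (φ.submatrix ε id) := by
    refine ⟨by rw [ε.surjective.range_comp]; exact h.span_eq_top, ?_⟩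
    ext v
    have h2 := SetLike.ext_iff.1 h.range_eq_ker (v ∘ ε.symm)
    rw [LinearMap.mem_ker, Fintype.linearCombination_apply, ← ε.sum_comp] at h2
    simp only [Function.comp_apply, Equiv.symm_apply_apply] at h2
    rw [LinearMap.mem_ker, Fintype.linearCombination_apply]
    simp only [Function.comp_apply]
    rw [← h2, LinearMap.mem_range, LinearMap.mem_range]
    refine exists_congr fun c => ⟨fun hc => ?_, fun hc => ?_⟩
    · ext i
      rw [← hc]
      simp [Matrix.mulVec, dotProduct]
    · ext i
      have := congrFun hc (ε i)
      simpa [Matrix.mulVec, dotProduct] using this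
  refine le_trans ?_ (le_iSup_of_le n <| le_iSup_of_le m <| le_iSup_of_le (x ∘ ε) <|
    le_iSup_of_le (φ.submatrix ε id) <| le_iSup_of_le h1 le_rfl)
  refine minorsIdeal_le fun f g => ?_
  have := det_submatrix_mem_minorsIdeal (φ.submatrix ε id) (f.trans ε.symm.toEmbedding) g
  convert this using 2
  ext i j
  simp

theorem minorsIdeal_fromRows_zero_le {ι α : Type*} {r : ℕ} (φ : Matrix ι (Fin r) S) :
    minorsIdeal r (Matrix.fromRows φ (0 : Matrix α (Fin r) S)) ≤ minorsIdeal r φ := by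
  refine minorsIdeal_le_of_cols fun f => ?_
  by_cases h : ∃ i a, f i = Sum.inr a
  · obtain ⟨i, a, hi⟩ := h
    rw [Matrix.det_eq_zero_of_row_eq_zero i fun j => by simp [hi]]
    exact zero_mem _
  · push Not at h
    have h1 (i : Fin r) : ∃ a, f i = Sum.inl a := by
      rcases hf : f i with a | a
      · exact ⟨a, rfl⟩
      · exact absurd hf (h i a)
    choose f' hf' using h1
    have hinj : Function.Injective f' := fun i j hij => f.injective (by rw [hf', hf', hij])
    have := det_submatrix_equiv_mem φ ⟨f', hinj⟩
    convert this using 2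
    ext i j
    simp [hf']

theorem one_submatrix_mul {ι α κ : Type*} [Fintype ι] [DecidableEq ι] (f : α → ι)
    (N : Matrix ι κ S) : (1 : Matrix ι ι S).submatrix f id * N = N.submatrix f id := by
  ext i j
  simp [Matrix.mul_apply, Matrix.one_apply]

/-- If a module of rank `e` has a presentation with `n` generators and `n - e` relations, then its
`e`-th Fitting ideal is generated by the maximal minors of this presentation. -/
theorem IsPresentedBy.fittingIdeal_le [Nontrivial S] {ι : Type*} [Fintype ι] [DecidableEq ι]
    {r e : ℕ} {x : ι → M} {φ : Matrix ι (Fin r) S} (h : IsPresentedBy x φ)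
    (σ : Fin r ⊕ Fin e ≃ ι) {g : M →ₗ[S] (Fin e → S)} {b : Fin e → M} {t : S}
    (hg : IsCoordinates g b t) : fittingIdeal S M e ≤ minorsIdeal r φ := by
  refine iSup_le fun n' => iSup_le fun m' => iSup_le fun x' => iSup_le fun φ' => iSup_le fun h' => ?_
  -- Rules out truncation in `n' - e`, which the size count for the block matrices below requires.
  -- The independent elements `b` give an injection of S^e into S^n'.
  have hn' : e ≤ n' := by
    obtain ⟨C, hC⟩ := exists_matrix_sum_eq h'.span_eq_top b
    have hinj : Function.Injective C.mulVecLin := by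
      rw [← LinearMap.ker_eq_bot, LinearMap.ker_eq_bot']
      intro u hu
      have h1 : ∑ i, u i • b i = 0 := by
        have h2 := sum_mul_smul hC (Matrix.of fun i (_ : Unit) => u i) ()
        simp only [Matrix.of_apply] at h2
        rw [← h2]
        refine Finset.sum_eq_zero fun i _ => ?_
        have h3 := congrFun hu i
        have h4 : (C * Matrix.of fun i (_ : Unit) => u i) i () = 0 := by
          simpa [Matrix.mul_apply, Matrix.mulVec, dotProduct] using h3
        rw [h4, zero_smul]
      exact hg.eq_zero_of_sum_eq_zero h1
    simpa using card_le_of_injective S C.mulVecLin hinj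
  refine minorsIdeal_le fun f q => ?_
  obtain ⟨A, hA⟩ := exists_matrix_sum_eq h.span_eq_top x'
  obtain ⟨B, hB⟩ := exists_matrix_sum_eq h'.span_eq_top x
  let ρ' := φ'.submatrix id q
  obtain ⟨C₁, hC₁⟩ := h.exists_mul_eq (A * B - 1) fun j => by
    simp only [Matrix.sub_apply, sub_smul, Finset.sum_sub_distrib, sum_mul_smul hA, hB]
    simp [Matrix.one_apply, ite_smul]
  obtain ⟨C₂, hC₂⟩ := h.exists_mul_eq (A * ρ') fun j => by
    rw [sum_mul_smul hA]
    exact h'.sum_eq_zero (q j)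
  let sel : Matrix (Fin (n' - e)) (Fin n') S := (1 : Matrix (Fin n') (Fin n') S).submatrix f id
  -- Both factors are square up to reindexing, since |ι| = r + e. The relations `A * B - 1 = φ * C₁`
  -- and `A * ρ' = φ * C₂` make the product block triangular with determinant ± the given minor of
  -- `φ'`, while expanding `Φ` along its first r columns puts its determinant into the ideal of
  -- maximal minors of `φ`.
  let Φ : Matrix (ι ⊕ Fin (n' - e)) (Fin r ⊕ Fin n') S := Matrix.fromBlocks φ A 0 (-sel)
  let C : Matrix (Fin r ⊕ Fin n') (ι ⊕ Fin (n' - e)) S := Matrix.fromBlocks C₁ C₂ (-B) (-ρ')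
  have hprod : Φ * C = Matrix.fromBlocks (-1) 0 (B.submatrix f id) (ρ'.submatrix f id) := by
    simp only [Φ, C, Matrix.fromBlocks_multiply, hC₁, hC₂, Matrix.mul_neg, Matrix.neg_mul, neg_neg,
      sel, one_submatrix_mul, Matrix.zero_mul, zero_add]
    congr 1
    · abel
    · exact add_neg_cancel _
  have hcard := Fintype.card_congr σ
  rw [Fintype.card_sum, Fintype.card_fin, Fintype.card_fin] at hcard
  let υ : Fin r ⊕ Fin n' ≃ ι ⊕ Fin (n' - e) := Fintype.equivOfCardEq (by
    simp only [Fintype.card_sum, Fintype.card_fin]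
    omega)
  have h1 : (Φ.submatrix υ id).det ∈ minorsIdeal r φ :=
    minorsIdeal_fromRows_zero_le (α := Fin (n' - e)) φ (by
      have h2 := det_mem_minorsIdeal_cols Φ υ
      convert h2 using 2
      ext (i | i) j <;> simp [Φ])
  have h2 : (Φ * C).det = (Φ.submatrix υ id).det * (C.submatrix id υ).det := by
    rw [← Matrix.det_submatrix_equiv_self υ, ← Matrix.det_mul]
    congr 1
  rw [hprod, Matrix.det_fromBlocks_zero₁₂, Matrix.det_neg, Matrix.det_one, mul_one] at h2
  have h3 : (φ'.submatrix f q).det =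
      ((-1) ^ Fintype.card ι * (C.submatrix id υ).det) * (Φ.submatrix υ id).det := by
    have h4 : (φ'.submatrix f q).det = (ρ'.submatrix f id).det := rfl
    rw [mul_assoc, mul_comm (C.submatrix id υ).det, ← h2, ← mul_assoc, ← mul_pow, h4]
    simp
  rw [h3]
  exact Ideal.mul_mem_left _ _ h1

theorem minorsIdeal_mul_le {ι : Type*} {r : ℕ} (A : Matrix ι (Fin r) S)
    (C : Matrix (Fin r) (Fin r) S) : minorsIdeal r (A * C) ≤ minorsIdeal r A := by
  refine minorsIdeal_le_of_cols fun f => ?_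
  have : (A * C).submatrix f id = A.submatrix f id * C := rfl
  rw [this, Matrix.det_mul, mul_comm]
  exact Ideal.mul_mem_left _ _ (det_submatrix_equiv_mem A f)

theorem exists_isPresentedBy [IsNoetherianRing S] {ι : Type*} [Fintype ι] {x : ι → M}
    (hx : Submodule.span S (Set.range x) = ⊤) :
    ∃ (m : ℕ) (φ : Matrix ι (Fin m) S), IsPresentedBy x φ := by
  obtain ⟨m, v, hv⟩ := Module.Finite.exists_fin (R := S)
    (M := LinearMap.ker (Fintype.linearCombination S x))
  refine ⟨m, (Matrix.of fun j i => (v j : ι → S) i).transpose, hx, ?_⟩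
  rw [Matrix.range_mulVecLin]
  have h1 := congrArg (Submodule.map (LinearMap.ker (Fintype.linearCombination S x)).subtype) hv
  rw [Submodule.map_span, Submodule.map_top, Submodule.range_subtype, ← Set.range_comp] at h1
  exact h1

theorem IsPresentedBy.append {ι : Type*} [Fintype ι] {m r : ℕ} {x : ι → M}
    {φ : Matrix ι (Fin m) S} (h : IsPresentedBy x φ) (W : Matrix ι (Fin r) S)
    (hW : ∀ j, ∑ i, W i j • x i = 0) :
    IsPresentedBy x ((Matrix.fromCols φ W).submatrix id (finSumFinEquiv (m := m) (n := r)).symm) := by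
  refine ⟨h.span_eq_top, ?_⟩
  have h1 := h.range_eq_ker
  rw [Matrix.range_mulVecLin] at h1 ⊢
  rw [← h1]
  apply le_antisymm
  · refine Submodule.span_le.2 ?_
    rintro _ ⟨j, rfl⟩
    obtain ⟨j, rfl⟩ := finSumFinEquiv.surjective j
    rcases j with j | j
    · refine Submodule.subset_span ⟨j, ?_⟩
      ext i
      simp
    · rw [h1]
      simpa [Fintype.linearCombination_apply] using hW j
  · refine Submodule.span_mono ?_
    rintro _ ⟨j, rfl⟩
    refine ⟨finSumFinEquiv (Sum.inl j), ?_⟩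
    ext i
    simp

end Presentation

/-! ### Projective dimension one and free relation modules -/

section ProjectiveDimension

open CategoryTheory

theorem projective_iff_of_shortExact {A : Type u} [CommRing A] {K P M : Type u} [AddCommGroup K]
    [AddCommGroup P] [AddCommGroup M] [Module A K] [Module A P] [Module A M]
    [Module.Projective A P] (f : K →ₗ[A] P) (g : P →ₗ[A] M) (hf : Function.Injective f)
    (hfg : Function.Exact f g) (hg : Function.Surjective g) :
    HasProjectiveDimensionLT (ModuleCat.of A M) 2 ↔ Module.Projective A K := by
  let C : ShortComplex (ModuleCat.{u} A) :=
    ShortComplex.mk (ModuleCat.ofHom f) (ModuleCat.ofHom g) (by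
      ext k
      exact hfg.apply_apply_eq_zero k)
  have hC : C.ShortExact :=
    { exact := (ShortComplex.ShortExact.moduleCat_exact_iff_function_exact C).2 hfg
      mono_f := (ModuleCat.mono_iff_injective _).2 hf
      epi_g := (ModuleCat.epi_iff_surjective _).2 hg }
  have hP : Projective C.X₂ := (IsProjective.iff_projective P).1 inferInstance
  have h1 := hC.hasProjectiveDimensionLT_X₃_iff 0 hP
  rw [zero_add, zero_add, ← projective_iff_hasProjectiveDimensionLT_one] at h1
  exact h1.trans (IsProjective.iff_projective K).symm

/-- Flat base change preserves a projective resolution of length one, and whether the first syzygy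
is projective does not depend on the chosen generators. -/
theorem projective_ker_baseChange {R : Type u} [CommRing R] {E : Type u} [AddCommGroup E]
    [Module R E] [Module.Finite R E]
    (hpd : projectiveDimension (ModuleCat.of R E) = 1) (S : Type u) [CommRing S] [Algebra R S]
    [Module.Flat R S] {ι : Type} [Fintype ι] {x : ι → S ⊗[R] E}
    (hx : Submodule.span S (Set.range x) = ⊤) :
    Module.Projective S (LinearMap.ker (Fintype.linearCombination S x)) := by
  have h2 : HasProjectiveDimensionLT (ModuleCat.of R E) 2 := by
    have : HasProjectiveDimensionLE (ModuleCat.of R E) 1 :=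
      (projectiveDimension_le_iff _ _).1 hpd.le
    exact this
  obtain ⟨n, y, hy⟩ := Module.Finite.exists_fin (R := R) (M := E)
  have surj {A : Type u} [CommRing A] {N : Type u} [AddCommGroup N] [Module A N] {κ : Type}
      [Fintype κ] {z : κ → N} (hz : Submodule.span A (Set.range z) = ⊤) :
      Function.Surjective (Fintype.linearCombination A z) := by
    rw [← LinearMap.range_eq_top, Fintype.range_linearCombination, hz]
  let π := Fintype.linearCombination R y
  have hex : Function.Exact (LinearMap.ker π).subtype π := LinearMap.exact_subtype_ker_map π
  have hproj := (projective_iff_of_shortExact (LinearMap.ker π).subtype π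
    (Submodule.subtype_injective _) hex (surj hy)).1 h2
  have h3 : HasProjectiveDimensionLT (ModuleCat.of S (S ⊗[R] E)) 2 :=
    (projective_iff_of_shortExact ((LinearMap.ker π).subtype.baseChange S) (π.baseChange S)
      (Module.Flat.lTensor_preserves_injective_linearMap _ (Submodule.subtype_injective _))
      (lTensor_exact S hex (surj hy))
      (LinearMap.lTensor_surjective S (surj hy))).2 inferInstance
  let π' := Fintype.linearCombination S x
  exact (projective_iff_of_shortExact (LinearMap.ker π').subtype π'
    (Submodule.subtype_injective _) (LinearMap.exact_subtype_ker_map π') (surj hx)).1 h3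

/-- If the module of relations is free, its rank is the number of generators minus `e`. -/
theorem exists_isPresentedBy_of_free_ker {S : Type u} [CommRing S] [Nontrivial S] {M : Type v}
    [AddCommGroup M] [Module S M] {ι : Type*} [Fintype ι] {x : ι → M}
    (hx : Submodule.span S (Set.range x) = ⊤)
    [Module.Free S (LinearMap.ker (Fintype.linearCombination S x))]
    [Module.Finite S (LinearMap.ker (Fintype.linearCombination S x))] {r e : ℕ}
    (hι : Fintype.card ι = r + e) {g : M →ₗ[S] (Fin e → S)} {b : Fin e → M} {t : S}
    (hg : IsCoordinates g b t) : ∃ φ : Matrix ι (Fin r) S, IsPresentedBy x φ := by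
  set K := LinearMap.ker (Fintype.linearCombination S x) with hK
  let B := Module.finBasis S K
  set q := Module.finrank S K
  obtain ⟨β, hβ⟩ := exists_matrix_sum_eq hx b
  have hgx (v : ι → S) : g (Fintype.linearCombination S x v) = ∑ i, v i • g (x i) := by
    simp [Fintype.linearCombination_apply]
  have hβx (u : Fin e → S) : Fintype.linearCombination S x (β.mulVec u) = ∑ i, u i • b i := by
    have h2 := sum_mul_smul hβ (Matrix.of fun i (_ : Unit) => u i) ()
    simp only [Matrix.of_apply] at h2
    rw [← h2, Fintype.linearCombination_apply]
    rfl
  -- The relations together with lifts of the independent elements `b` stay independent in S^ι.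
  have hle1 : q + e ≤ Fintype.card ι := by
    let L : (Fin q ⊕ Fin e → S) →ₗ[S] (ι → S) :=
      (K.subtype ∘ₗ B.equivFun.symm.toLinearMap) ∘ₗ LinearMap.funLeft S S Sum.inl +
        β.mulVecLin ∘ₗ LinearMap.funLeft S S Sum.inr
    have hL : Function.Injective L := by
      rw [← LinearMap.ker_eq_bot, LinearMap.ker_eq_bot']
      intro w hw
      have h1 : L w = (B.equivFun.symm (w ∘ Sum.inl)).1 + β.mulVec (w ∘ Sum.inr) := rfl
      rw [h1] at hw
      have h2 := congrArg (Fintype.linearCombination S x) hw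
      rw [map_add, LinearMap.mem_ker.1 (B.equivFun.symm (w ∘ Sum.inl)).2, zero_add, hβx,
        map_zero] at h2
      have h4 := hg.eq_zero_of_sum_eq_zero h2
      rw [h4, Matrix.mulVec_zero, add_zero] at hw
      have h5 : w ∘ Sum.inl = 0 := by
        rw [← LinearEquiv.map_eq_zero_iff B.equivFun.symm]
        exact Subtype.ext hw
      ext (i | i)
      · exact congrFun h5 i
      · exact congrFun h4 i
    simpa using card_le_of_injective S L hL
  -- Conversely, `v` is determined by `G v` and the relation `t • v - β (G v)`, because `t` is
  -- regular.
  have hle2 : Fintype.card ι ≤ q + e := by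
    let G : (ι → S) →ₗ[S] (Fin e → S) := g ∘ₗ Fintype.linearCombination S x
    let T : (ι → S) →ₗ[S] (ι → S) := t • LinearMap.id - β.mulVecLin ∘ₗ G
    have hT (v : ι → S) : T v ∈ K := by
      rw [hK, LinearMap.mem_ker]
      change Fintype.linearCombination S x (t • v - β.mulVec (G v)) = 0
      rw [map_sub, hβx, map_smul, hg.smul_eq]
      exact sub_self _
    let L : (ι → S) →ₗ[S] (Fin q → S) × (Fin e → S) :=
      (B.equivFun.toLinearMap ∘ₗ T.codRestrict K hT).prod G
    have hL : Function.Injective L := by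
      rw [← LinearMap.ker_eq_bot, LinearMap.ker_eq_bot']
      intro v hv
      obtain ⟨h1, h2⟩ := Prod.ext_iff.1 hv
      change B.equivFun (T.codRestrict K hT v) = 0 at h1
      change G v = 0 at h2
      rw [LinearEquiv.map_eq_zero_iff] at h1
      have h3 : T v = 0 := congrArg Subtype.val h1
      change t • v - β.mulVec (G v) = 0 at h3
      rw [h2, Matrix.mulVec_zero, sub_zero] at h3
      exact eq_zero_of_smul_eq_zero hg.mem h3
    simpa using card_le_of_injective S
      ((LinearEquiv.sumArrowLequivProdArrow (Fin q) (Fin e) S S).symm.toLinearMap ∘ₗ L)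
      ((LinearEquiv.sumArrowLequivProdArrow (Fin q) (Fin e) S S).symm.injective.comp hL)
  have hq : q = r := by omega
  clear_value q
  subst hq
  refine ⟨(Matrix.of fun j i => (B j : ι → S) i).transpose, hx, ?_⟩
  rw [Matrix.range_mulVecLin]
  have h1 := congrArg (Submodule.map K.subtype) B.span_eq
  rw [Submodule.map_span, Submodule.map_top, Submodule.range_subtype, ← Set.range_comp] at h1
  exact h1

end ProjectiveDimension

/-! ### Generators of an ideal isomorphic to a quotient -/

section RankOne

variable {S : Type u} [CommRing S] {M : Type v} [AddCommGroup M] [Module S M]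

theorem minorsIdeal_one_row {ι : Type*} (g : ι → S) :
    minorsIdeal 1 (Matrix.of fun (_ : Fin 1) i => g i) = Ideal.span (Set.range g) := by
  apply le_antisymm
  · refine minorsIdeal_le fun p q => ?_
    rw [Matrix.det_fin_one]
    exact Ideal.subset_span ⟨q 0, rfl⟩
  · refine Ideal.span_le.2 ?_
    rintro _ ⟨i, rfl⟩
    have := det_submatrix_mem_minorsIdeal (Matrix.of fun (_ : Fin 1) i => g i)
      (Function.Embedding.refl _) ⟨fun _ : Fin 1 => i, fun _ _ _ => Subsingleton.elim _ _⟩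
    rw [Matrix.det_fin_one] at this
    exact this

/-- The generators of an ideal isomorphic to a quotient by some of the generators. -/
theorem exists_ideal_generators {α β : Type*} [Fintype α] [Fintype β] {x : α ⊕ β → M}
    (hx : Submodule.span S (Set.range x) = ⊤) {F : Submodule S M}
    (hF : F = Submodule.span S (Set.range fun j => x (Sum.inl j))) {I : Ideal S}
    (θ : I ≃ₗ[S] M ⧸ F) :
    ∃ g : β → S, Ideal.span (Set.range g) = I ∧
      (∀ v : α ⊕ β → S, ∑ i, v i • x i = 0 → ∑ i, v (Sum.inr i) * g i = 0) ∧
      ∀ v : β → S, ∑ i, v i * g i = 0 →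
        ∃ u : α → S, ∑ j, u j • x (Sum.inl j) + ∑ i, v i • x (Sum.inr i) = 0 := by
  let L : M →ₗ[S] S := I.subtype ∘ₗ θ.symm.toLinearMap ∘ₗ F.mkQ
  have hL0 (m : M) : L m = 0 ↔ m ∈ F := by
    change ((θ.symm (F.mkQ m) : I) : S) = 0 ↔ _
    rw [ZeroMemClass.coe_eq_zero, LinearEquiv.map_eq_zero_iff, Submodule.mkQ_apply,
      Submodule.Quotient.mk_eq_zero]
  have hinl (j : α) : L (x (Sum.inl j)) = 0 := by
    rw [hL0, hF]
    exact Submodule.subset_span ⟨j, rfl⟩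
  have hrange : LinearMap.range L = I := by
    rw [LinearMap.range_comp, LinearMap.range_comp, Submodule.range_mkQ, Submodule.map_top,
      LinearEquiv.range, Submodule.map_top, Submodule.range_subtype]
  refine ⟨fun i => L (x (Sum.inr i)), ?_, fun v hv => ?_, fun v hv => ?_⟩
  · rw [← hrange, LinearMap.range_eq_map, ← hx, Submodule.map_span, ← Set.range_comp]
    apply le_antisymm
    · refine Submodule.span_mono ?_
      rintro _ ⟨i, rfl⟩
      exact ⟨Sum.inr i, rfl⟩
    · refine Submodule.span_le.2 ?_
      rintro _ ⟨i | i, rfl⟩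
      · simp only [Function.comp_apply, hinl]
        exact zero_mem _
      · exact Submodule.subset_span ⟨i, rfl⟩
  · have := congrArg L hv
    simpa [hinl] using this
  · have h1 : ∑ i, v i • x (Sum.inr i) ∈ F := by
      rw [← hL0]
      simpa using hv
    rw [hF] at h1
    obtain ⟨u, hu⟩ := (Submodule.mem_span_range_iff_exists_fun S).1 h1
    refine ⟨fun j => - u j, ?_⟩
    rw [← hu]
    simp

end RankOne

/-! ### Assembly of the main theorem -/

section Main

variable {R : Type u} [CommRing R] [IsLocalRing R] {E : Type u} [AddCommGroup E] [Module R E]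
  {k d : ℕ} {a : Fin k → E}

theorem exists_isExtendedGeneratingFamily [Module.Finite R E] (a : Fin k → E) :
    ∃ (r : ℕ) (x : Fin d ⊕ Fin (r + 1) → NagataExt R (Fin k × Fin d) ⊗[R] E),
      IsExtendedGeneratingFamily a x := by
  obtain ⟨n, y, hy⟩ := Module.Finite.exists_fin (R := R) (M := E)
  have h := span_range_one_tmul (NagataExt R (Fin k × Fin d)) hy
  -- The second block must have r + 1 elements. With r = n this leaves one slot beyond the n given
  -- generators, filled by 0.
  refine ⟨n, Sum.elim (fun j => genericElement a j)
    (Fin.snoc (α := fun _ => NagataExt R (Fin k × Fin d) ⊗[R] E) (fun i => 1 ⊗ₜ y i) 0),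
    fun j => rfl, ?_⟩
  rw [eq_top_iff, ← h]
  refine Submodule.span_mono ?_
  rintro _ ⟨i, rfl⟩
  exact ⟨Sum.inr i.castSucc, by simp⟩

/-- The data attached to a generic Bourbaki ideal and an extended generating family: generators of
the ideal, and the lift of relations. -/
theorem IsGenericBourbakiIdeal.exists_generators {r : ℕ} {I : Ideal (NagataExt R (Fin k × Fin d))}
    (hI : IsGenericBourbakiIdeal (d + 1) a I)
    {x : Fin d ⊕ Fin (r + 1) → NagataExt R (Fin k × Fin d) ⊗[R] E}
    (hx : IsExtendedGeneratingFamily a x) :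
    ∃ g : Fin (r + 1) → NagataExt R (Fin k × Fin d), Ideal.span (Set.range g) = I ∧
      (∀ v : Fin d ⊕ Fin (r + 1) → NagataExt R (Fin k × Fin d),
        ∑ i, v i • x i = 0 → ∑ i, v (Sum.inr i) * g i = 0) ∧
      ∀ v : Fin (r + 1) → NagataExt R (Fin k × Fin d), ∑ i, v i * g i = 0 →
        ∃ u : Fin d → NagataExt R (Fin k × Fin d),
          ∑ j, u j • x (Sum.inl j) + ∑ i, v i • x (Sum.inr i) = 0 := by
  obtain ⟨θ⟩ := hI.iso
  exact exists_ideal_generators hx.span_eq_top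
    (F := genericSubmodule d a) (by simp only [hx.inl]; rfl) θ

variable {r : ℕ} {I : Ideal (NagataExt R (Fin k × Fin d))}
  {x : Fin d ⊕ Fin (r + 1) → NagataExt R (Fin k × Fin d) ⊗[R] E}

/-- The enumeration of the generators. -/
noncomputable def finSumSumEquiv (d r : ℕ) : Fin r ⊕ Fin (d + 1) ≃ Fin d ⊕ Fin (r + 1) :=
  Fintype.equivOfCardEq (by simp; omega)

theorem IsGenericBourbakiIdeal.nonempty_equiv [Module.Finite R E] (hrank : HasRank R E (d + 1))
    (hI : IsGenericBourbakiIdeal (d + 1) a I) (hx : IsExtendedGeneratingFamily a x)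
    {m : ℕ} {φ : Matrix (Fin d ⊕ Fin (r + 1)) (Fin m) (NagataExt R (Fin k × Fin d))}
    (c : Fin r ↪ Fin m) (hφ : IsPresentedBy x φ)
    (hψ : 1 ≤ idealGrade (minorsIdeal r (φ.submatrix Sum.inr c))) :
    Nonempty (I ≃ₗ[NagataExt R (Fin k × Fin d)] minorsIdeal r (φ.submatrix Sum.inr c)) := by
  obtain ⟨g, hgI, hg, -⟩ := hI.exists_generators hx
  have hI0 := hI.exists_mem_nonZeroDivisors hrank
  rw [← hgI, ← minorsIdeal_one_row] at hI0 ⊢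
  have h := nonempty_minorsIdeal_equiv (G := Matrix.of fun (_ : Fin 1) i => g i)
    (ρ := φ.submatrix Sum.inr c) (by
      ext i j
      have h1 := hg (fun i => φ i (c j)) (hφ.sum_eq_zero (c j))
      simpa [Matrix.mul_apply, mul_comm] using h1) finSumFinEquiv hI0
    (one_le_idealGrade_iff.1 hψ)
  exact ⟨h.some.symm⟩

/-- A relation on the generators of I says that a combination of x_e, …, x_n lies in F, so it
extends by coefficients at x_1, …, x_{e-1} to a relation in E''. The lower block is unchanged by the
lift. -/
theorem exists_lift_relations [IsNoetherianRing R] [Module.Finite R E]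
    (hrank : HasRank R E (d + 1)) (hd : 1 ≤ d) (hI : IsGenericBourbakiIdeal (d + 1) a I)
    (hx : IsExtendedGeneratingFamily a x) :
    ∃ W : Matrix (Fin d ⊕ Fin (r + 1)) (Fin r) (NagataExt R (Fin k × Fin d)),
      (∀ j, ∑ i, W i j • x i = 0) ∧
        ∃ u ∈ minorsIdeal r (W.submatrix Sum.inr id), u ∈ (NagataExt R (Fin k × Fin d))⁰ := by
  obtain ⟨g, hgI, -, hg⟩ := hI.exists_generators hx
  have hI0 := hI.exists_mem_nonZeroDivisors hrank
  rw [← hgI] at hI0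
  obtain ⟨l⟩ := hI.nonempty_fin hrank
  obtain ⟨c, hc⟩ := exists_seq_isUnit_sub (R := R) (l, (⟨0, hd⟩ : Fin d))
  obtain ⟨ψ, hψ, hψ0⟩ := exists_relations hc g hI0
  choose u hu using fun j => hg (fun i => ψ i j) (hψ j)
  refine ⟨Matrix.of fun i j => Sum.elim (u j) (fun i => ψ i j) i, fun j => ?_, ?_⟩
  · rw [Fintype.sum_sum_type]
    exact hu j
  · exact hψ0

theorem minorsIdeal_rho_equiv [Module.Finite R E]
    {g : E →ₗ[R] (Fin (d + 1) → R)} {b : Fin (d + 1) → E} {t : R} (hg : IsCoordinates g b t)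
    (hx : IsExtendedGeneratingFamily a x)
    {m : ℕ} {φ : Matrix (Fin d ⊕ Fin (r + 1)) (Fin m) (NagataExt R (Fin k × Fin d))}
    (c : Fin r ↪ Fin m) (hφ : IsPresentedBy x φ)
    (hρ : ∃ u ∈ minorsIdeal r (φ.submatrix id c), u ∈ (NagataExt R (Fin k × Fin d))⁰) :
    Nonempty (minorsIdeal r (φ.submatrix id c) ≃ₗ[NagataExt R (Fin k × Fin d)]
      detIdeal (coordBaseChange (NagataExt R (Fin k × Fin d)) g)) := by
  set S := NagataExt R (Fin k × Fin d)
  have h0 := (hg.baseChange S).exists_mem_detIdeal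
  rw [detIdeal_eq_minorsIdeal _ hx.span_eq_top] at h0 ⊢
  refine nonempty_minorsIdeal_equiv ?_ (finSumSumEquiv d r) h0 hρ
  ext i j
  have h1 := congrArg (coordBaseChange S g) (hφ.sum_eq_zero (c j))
  have h2 := congrFun h1 i
  rw [map_sum] at h2
  simpa [Matrix.mul_apply, mul_comm, Finset.sum_apply] using h2

theorem genericBourbakiIdeal_minors [IsNoetherianRing R] [Module.Finite R E] (hd : 1 ≤ d)
    (hrank : HasRank R E (d + 1)) (hI : IsGenericBourbakiIdeal (d + 1) a I)
    (hx : IsExtendedGeneratingFamily a x) :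
    (∃ (m : ℕ) (φ : Matrix (Fin d ⊕ Fin (r + 1)) (Fin m) (NagataExt R (Fin k × Fin d)))
        (c : Fin r ↪ Fin m), IsPresentedBy x φ ∧
          1 ≤ idealGrade (minorsIdeal r (φ.submatrix Sum.inr c))) ∧
      (∀ (m : ℕ) (φ : Matrix (Fin d ⊕ Fin (r + 1)) (Fin m) (NagataExt R (Fin k × Fin d)))
          (c : Fin r ↪ Fin m), IsPresentedBy x φ →
          1 ≤ idealGrade (minorsIdeal r (φ.submatrix Sum.inr c)) →
          Nonempty (I ≃ₗ[NagataExt R (Fin k × Fin d)]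
            minorsIdeal r (φ.submatrix Sum.inr c)) ∧
          minorsIdeal r (φ.submatrix Sum.inr c) ≤ minorsIdeal r (φ.submatrix id c) ∧
          minorsIdeal r (φ.submatrix id c) ≤
            fittingIdeal (NagataExt R (Fin k × Fin d))
              (NagataExt R (Fin k × Fin d) ⊗[R] E) (d + 1) ∧
          RepresentsNorm (NagataExt R (Fin k × Fin d) ⊗[R] E) (d + 1)
            (minorsIdeal r (φ.submatrix id c)) ∧
          ∀ f : E →ₗ[R] (Fin (d + 1) → R), HasRank R (LinearMap.range f) (d + 1) →
            Nonempty (minorsIdeal r (φ.submatrix id c) ≃ₗ[NagataExt R (Fin k × Fin d)]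
              (detIdeal f).map (algebraMap R (NagataExt R (Fin k × Fin d))))) ∧
      (CategoryTheory.projectiveDimension (ModuleCat.of R E) = 1 →
        (∃ φ : Matrix (Fin d ⊕ Fin (r + 1)) (Fin r) (NagataExt R (Fin k × Fin d)),
          IsPresentedBy x φ) ∧
        ∀ φ : Matrix (Fin d ⊕ Fin (r + 1)) (Fin r) (NagataExt R (Fin k × Fin d)),
          IsPresentedBy x φ →
          1 ≤ idealGrade (minorsIdeal r (φ.submatrix Sum.inr id)) ∧
          Nonempty (I ≃ₗ[NagataExt R (Fin k × Fin d)]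
            minorsIdeal r (φ.submatrix Sum.inr id)) ∧
          minorsIdeal r (φ.submatrix Sum.inr id) ≤ minorsIdeal r φ ∧
          minorsIdeal r φ =
            fittingIdeal (NagataExt R (Fin k × Fin d))
              (NagataExt R (Fin k × Fin d) ⊗[R] E) (d + 1)) := by
  obtain ⟨g, b, t, hg⟩ := hrank.exists_isCoordinates
  have hg' := hg.baseChange (NagataExt R (Fin k × Fin d))
  obtain ⟨W, hW, hW0⟩ := exists_lift_relations hrank hd hI hx
  have hle {m : ℕ} (φ : Matrix (Fin d ⊕ Fin (r + 1)) (Fin m) (NagataExt R (Fin k × Fin d)))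
      (c : Fin r ↪ Fin m) :
      minorsIdeal r (φ.submatrix Sum.inr c) ≤ minorsIdeal r (φ.submatrix id c) :=
    minorsIdeal_submatrix_le r (φ.submatrix id c) Function.Embedding.inr
      (Function.Embedding.refl _)
  have hfit {m : ℕ} {φ : Matrix (Fin d ⊕ Fin (r + 1)) (Fin m) (NagataExt R (Fin k × Fin d))}
      (hφ : IsPresentedBy x φ) : minorsIdeal r φ ≤
        fittingIdeal (NagataExt R (Fin k × Fin d))
          (NagataExt R (Fin k × Fin d) ⊗[R] E) (d + 1) :=
    hφ.minorsIdeal_le_fittingIdeal finSumFinEquiv.symm (by omega)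
  refine ⟨?_, fun m φ c hφ hψ => ?_, fun hpd => ⟨?_, fun φ hφ => ?_⟩⟩
  · obtain ⟨m, φ, hφ⟩ := exists_isPresentedBy hx.span_eq_top
    -- The constructed relations are appended to an arbitrary presentation, and the last r columns
    -- are chosen.
    refine ⟨m + r, _, ⟨Fin.natAdd m, Fin.natAdd_injective r m⟩, hφ.append W hW,
      one_le_idealGrade_iff.2 ?_⟩
    convert hW0 using 5
    ext i j
    simp
  · have hρ : ∃ u ∈ minorsIdeal r (φ.submatrix id c), u ∈ (NagataExt R (Fin k × Fin d))⁰ := by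
      obtain ⟨u, hu, hu0⟩ := one_le_idealGrade_iff.1 hψ
      exact ⟨u, hle φ c hu, hu0⟩
    have hequiv := minorsIdeal_rho_equiv hg hx c hφ hρ
    refine ⟨hI.nonempty_equiv hrank hx c hφ hψ, hle φ c, ?_,
      hg'.representsNorm.of_equiv hequiv, fun f hf => ?_⟩
    · exact (minorsIdeal_submatrix_le r φ (Function.Embedding.refl _) c).trans (hfit hφ)
    · rw [← detIdeal_coordBaseChange]
      obtain ⟨u, hu, hu0⟩ := exists_mem_detIdeal_of_hasRank_range f hf
      have hf' : ∃ u ∈ detIdeal (coordBaseChange (NagataExt R (Fin k × Fin d)) f),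
          u ∈ (NagataExt R (Fin k × Fin d))⁰ := by
        rw [detIdeal_coordBaseChange]
        exact ⟨_, Ideal.mem_map_of_mem _ hu, algebraMap_mem_nonZeroDivisors _ hu0⟩
      exact ⟨hequiv.some.trans (hg'.nonempty_detIdeal_equiv _ hf').some.symm⟩
  · have hproj := projective_ker_baseChange hpd (NagataExt R (Fin k × Fin d)) hx.span_eq_top
    -- A finitely generated projective module over the local ring R'' is free.
    have := Module.free_of_flat_of_isLocalRing (R := NagataExt R (Fin k × Fin d))
      (P := LinearMap.ker (Fintype.linearCombination (NagataExt R (Fin k × Fin d)) x))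
    exact exists_isPresentedBy_of_free_ker hx.span_eq_top (by simp; omega) hg'
  · have hψ : 1 ≤ idealGrade (minorsIdeal r (φ.submatrix Sum.inr id)) := by
      -- The relations `W` factor through `φ` by a square matrix, so the maximal minors of the lower
      -- block of `W` are multiples of those of `φ`.
      obtain ⟨C, rfl⟩ := hφ.exists_mul_eq W hW
      obtain ⟨u, hu, hu0⟩ := hW0
      exact one_le_idealGrade_iff.2
        ⟨u, minorsIdeal_mul_le (φ.submatrix Sum.inr id) C hu, hu0⟩
    exact ⟨hψ, hI.nonempty_equiv hrank hx (Function.Embedding.refl _) hφ hψ,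
      hle φ (Function.Embedding.refl _),
      le_antisymm (hfit hφ) (hφ.fittingIdeal_le (finSumSumEquiv d r) hg')⟩

end Main

end BourbakiNorm

/-- Here `d = e - 1`, the number of generators `x_1, …, x_n` of `E''` is `n = (e - 1) + (r + 1)`,
so `r = n - e`; for an `n × m` matrix `φ` and a choice `c` of `n - e` of its columns, `ρ` is
the `n × (n - e)` matrix of these columns, and `ψ` consists of the last `n - e + 1` rows of `ρ`. -/
theorem proposition6p2 {R : Type u} [CommRing R] [IsLocalRing R] [IsNoetherianRing R]
    {E : Type u} [AddCommGroup E] [Module R E] [Module.Finite R E]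
    (e : ℕ) (he : 2 ≤ e) (hrank : HasRank R E e)
    (hgrade : 2 ≤ idealGrade (fittingIdeal R E e))
    (k : ℕ) (a : Fin k → E)
    (I : Ideal (NagataExt R (Fin k × Fin (e - 1))))
    (hI : IsGenericBourbakiIdeal e a I) :
    -- there are generating families extending `x_1, …, x_{e-1}`
    (∃ (r : ℕ) (x : Fin (e - 1) ⊕ Fin (r + 1) →
        NagataExt R (Fin k × Fin (e - 1)) ⊗[R] E),
      IsExtendedGeneratingFamily a x) ∧
    -- maps `f : E → R ^ e` of rank `e`, which are used to define `det_0(E)`, exist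
    (∃ f : E →ₗ[R] (Fin e → R), HasRank R (LinearMap.range f) e) ∧
    ∀ (r : ℕ) (x : Fin (e - 1) ⊕ Fin (r + 1) →
        NagataExt R (Fin k × Fin (e - 1)) ⊗[R] E),
      IsExtendedGeneratingFamily a x →
      -- there are presentations with a submatrix `ψ` as required
      (∃ (m : ℕ) (φ : Matrix (Fin (e - 1) ⊕ Fin (r + 1)) (Fin m)
            (NagataExt R (Fin k × Fin (e - 1)))) (c : Fin r ↪ Fin m),
          IsPresentedBy x φ ∧
          1 ≤ idealGrade (minorsIdeal r (φ.submatrix Sum.inr c))) ∧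
      -- for all of them, `I ≅ I_{n-e}(ψ) ⊆ I_{n-e}(ρ) ⊆ F_e(E'')` and
      -- `I_{n-e}(ρ) ≅ [[E'']] ≅ det_0(E) R''`
      (∀ (m : ℕ) (φ : Matrix (Fin (e - 1) ⊕ Fin (r + 1)) (Fin m)
            (NagataExt R (Fin k × Fin (e - 1)))) (c : Fin r ↪ Fin m),
          IsPresentedBy x φ →
          1 ≤ idealGrade (minorsIdeal r (φ.submatrix Sum.inr c)) →
          Nonempty (I ≃ₗ[NagataExt R (Fin k × Fin (e - 1))]
            minorsIdeal r (φ.submatrix Sum.inr c)) ∧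
          minorsIdeal r (φ.submatrix Sum.inr c) ≤
            minorsIdeal r (φ.submatrix id c) ∧
          minorsIdeal r (φ.submatrix id c) ≤
            fittingIdeal (NagataExt R (Fin k × Fin (e - 1)))
              (NagataExt R (Fin k × Fin (e - 1)) ⊗[R] E) e ∧
          RepresentsNorm (NagataExt R (Fin k × Fin (e - 1)) ⊗[R] E) e
            (minorsIdeal r (φ.submatrix id c)) ∧
          ∀ f : E →ₗ[R] (Fin e → R), HasRank R (LinearMap.range f) e →
            Nonempty (minorsIdeal r (φ.submatrix id c)
              ≃ₗ[NagataExt R (Fin k × Fin (e - 1))]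
              (detIdeal f).map
                (algebraMap R (NagataExt R (Fin k × Fin (e - 1)))))) ∧
      -- if `E` has projective dimension one, there are presentations with `n - e` columns, and
      -- for all of them (`ρ = φ`) the last inclusion is an equality
      (CategoryTheory.projectiveDimension (ModuleCat.of R E) = 1 →
        (∃ φ : Matrix (Fin (e - 1) ⊕ Fin (r + 1)) (Fin r)
            (NagataExt R (Fin k × Fin (e - 1))), IsPresentedBy x φ) ∧
        ∀ φ : Matrix (Fin (e - 1) ⊕ Fin (r + 1)) (Fin r)
            (NagataExt R (Fin k × Fin (e - 1))), IsPresentedBy x φ →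
          1 ≤ idealGrade (minorsIdeal r (φ.submatrix Sum.inr id)) ∧
          Nonempty (I ≃ₗ[NagataExt R (Fin k × Fin (e - 1))]
            minorsIdeal r (φ.submatrix Sum.inr id)) ∧
          minorsIdeal r (φ.submatrix Sum.inr id) ≤ minorsIdeal r φ ∧
          minorsIdeal r φ =
            fittingIdeal (NagataExt R (Fin k × Fin (e - 1)))
              (NagataExt R (Fin k × Fin (e - 1)) ⊗[R] E) e) := by
  obtain ⟨d, rfl⟩ : ∃ d, e = d + 1 := ⟨e - 1, by omega⟩
  refine ⟨exists_isExtendedGeneratingFamily a, ?_, fun r x hx =>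
    genericBourbakiIdeal_minors (by omega) hrank hI hx⟩
  obtain ⟨g, b, t, hg⟩ := hrank.exists_isCoordinates
  exact ⟨g, hg.hasRank_range⟩
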